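/- Let $G$ be a finite simple graph with $v(G)$ vertices and maximum degree $\Delta(G)$, and let $b\ge 1$ and $k\ge 0$ be integers. In the edge-colouring game with bias $b$ and $k$ colours on $G$, Maker and Breaker alternately take turns, starting with no edge coloured. In each of his turns Maker assigns one of the $k$ colours to one uncoloured edge; in each of his turns Breaker assigns colours to at least one and at most $b$ uncoloured edges. At all times adjacent edges must not receive the same colour. Maker wins if at the end all edges of $G$ are coloured; Breaker wins as soon as there is an uncoloured edge at which every colour is already used on an adjacent edge. The game chromatic index $\chi'_g(G,b)$ is the smallest $k$ for which Maker has a winning strategy. **Theorem.** There is an absolute constant $c>0$ such that for every integer $b\ge 1$ there is a constant $C(b)>0$, depending only on $b$, such that every finite graph $G$ with $\Delta(G)\ge C(b)\cdot\log v(G)$ satisfies $$\chi'_g(G,b)\le (2-c\,b^{-4})\,\Delta(G).$$ This holds no matter which of the two players starts, and it also holds, with the same constants, for the variant of the game in which Breaker is allowed to pass, that is, to colour no edge in a turn. -/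

import Mathlib

namespace EdgeColouringGame

/-- The two players of the game. -/
inductive Player
  | maker
  | breaker

variable {V : Type*}

/-- A partial colouring of the edges of `G` with `k` colours; `none` means uncoloured. -/
abbrev PartialColouring (G : SimpleGraph V) (k : ℕ) : Type _ :=
  G.edgeSet → Option (Fin k)

variable {G : SimpleGraph V} {k : ℕ}

/-- Two edges are adjacent if they are distinct and share a vertex. -/
def AdjacentEdges (e f : G.edgeSet) : Prop :=
  e ≠ f ∧ ∃ v : V, v ∈ (e : Sym2 V) ∧ v ∈ (f : Sym2 V)

/-- The colour `i` is available at the edge `e` if no adjacent edge has colour `i`. -/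
def Available (c : PartialColouring G k) (e : G.edgeSet) (i : Fin k) : Prop :=
  ∀ f : G.edgeSet, AdjacentEdges e f → c f ≠ some i

open Classical in
/-- `c'` arises from `c` by assigning an available colour to one uncoloured edge. -/
def ColoursEdge (c c' : PartialColouring G k) : Prop :=
  ∃ (e : G.edgeSet) (i : Fin k),
    c e = none ∧ Available c e i ∧ c' = Function.update c e (some i)

/-- `c'` arises from `c` by properly colouring exactly `m` uncoloured edges, one after the other. -/
def ColoursEdges : ℕ → PartialColouring G k → PartialColouring G k → Prop
  | 0, c, c' => c' = c
  | m + 1, c, c' => ∃ d, ColoursEdge c d ∧ ColoursEdges m d c'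

/-- A turn of Breaker in the game with bias `b`: he colours at most `b` edges, and at least one
edge unless he is allowed to pass. -/
def BreakerTurn (b : ℕ) (mayPass : Bool) (c c' : PartialColouring G k) : Prop :=
  ∃ m : ℕ, m ≤ b ∧ (mayPass = false → 1 ≤ m) ∧ ColoursEdges m c c'

/-- A strategy of Maker: it maps the history of the play (all positions so far, the current one
first) to the position that Maker wants to reach by his move. Whether this is a legal move is
checked in the definition of a play. -/
abbrev MakerStrategy (G : SimpleGraph V) (k : ℕ) : Type _ :=
  List (PartialColouring G k) → PartialColouring G k

/-- `Play b mayPass first σ p h`: the history `h` (current position first) can arise when Maker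
follows the strategy `σ`, Breaker moves legally, and the player `first` begins; it is then the turn
of the player `p`. Maker colours one edge per turn. -/
inductive Play (b : ℕ) (mayPass : Bool) (first : Player) (σ : MakerStrategy G k) :
    Player → List (PartialColouring G k) → Prop
  | start : Play b mayPass first σ first [fun _ => none]
  | maker (c : PartialColouring G k) (h : List (PartialColouring G k)) :
      Play b mayPass first σ Player.maker (c :: h) → ColoursEdge c (σ (c :: h)) →
      Play b mayPass first σ Player.breaker (σ (c :: h) :: c :: h)
  | breaker (c c' : PartialColouring G k) (h : List (PartialColouring G k)) :
      Play b mayPass first σ Player.breaker (c :: h) → BreakerTurn b mayPass c c' →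
      Play b mayPass first σ Player.maker (c' :: c :: h)

/-- The strategy `σ` is winning for Maker: every play according to `σ` that cannot be continued has
all edges coloured. (Plays are finite, as Maker colours a new edge in each of his turns. An
uncoloured edge at which all colours are blocked stays uncoloured forever, and a play in which `σ`
prescribes an illegal move ends there; so in both cases Maker loses.) -/
def IsWinning (b : ℕ) (mayPass : Bool) (first : Player) (σ : MakerStrategy G k) : Prop :=
  ∀ (p : Player) (c : PartialColouring G k) (h : List (PartialColouring G k)),
    Play b mayPass first σ p (c :: h) →
    (¬ ∃ (q : Player) (c' : PartialColouring G k), Play b mayPass first σ q (c' :: c :: h)) →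
    ∀ e : G.edgeSet, c e ≠ none

/-- Maker has a winning strategy in the game on `G` with `k` colours. -/
def MakerWins (G : SimpleGraph V) (b : ℕ) (mayPass : Bool) (first : Player) (k : ℕ) : Prop :=
  ∃ σ : MakerStrategy G k, IsWinning b mayPass first σ

/-- The game chromatic index with bias `b`: the smallest number of colours for which Maker has a
winning strategy. -/
noncomputable def gameChromaticIndex (G : SimpleGraph V) (b : ℕ) (mayPass : Bool)
    (first : Player) : ℕ :=
  sInf {k : ℕ | MakerWins G b mayPass first k}

/-- On a finite graph Maker wins if there are as many colours as edges, so that the infimum in the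
definition of the game chromatic index is a minimum. -/
theorem makerWins_card_edgeSet [Finite V] (G : SimpleGraph V) {b : ℕ} (hb : 1 ≤ b)
    (mayPass : Bool) (first : Player) :
    MakerWins G b mayPass first (Nat.card G.edgeSet) := by
  classical
  have key : ∀ c : PartialColouring G (Nat.card G.edgeSet), (∃ e, c e = none) →
      ∃ c', ColoursEdge c c' := by
    rintro c ⟨e, he⟩
    by_contra hcon
    have hall : ∀ i, ∃ f, c f = some i := by
      intro i
      by_contra hi
      push Not at hi
      exact hcon ⟨_, e, i, he, fun f _ => hi f, rfl⟩
    choose g hg using hall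
    have ginj : Function.Injective g := by
      intro i j hij
      have := hg i
      rw [hij, hg j] at this
      exact (Option.some.inj this).symm
    have gsurj : Function.Surjective g :=
      (ginj.bijective_of_nat_card_le (by simp)).2
    obtain ⟨i, hi⟩ := gsurj e
    have := hg i
    rw [hi, he] at this
    cases this
  choose! next hnext using key
  refine ⟨fun h => next (h.headD fun _ => none), ?_⟩
  intro p c h hplay hend e he
  apply hend
  have hs := hnext c ⟨e, he⟩
  cases p with
  | maker => exact ⟨_, _, Play.maker c h hplay hs⟩
  | breaker =>
    exact ⟨_, _, Play.breaker c (next c) h hplay ⟨1, hb, fun _ => le_rfl, next c, hs, rfl⟩⟩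

theorem makerWins_gameChromaticIndex [Finite V] (G : SimpleGraph V) {b : ℕ} (hb : 1 ≤ b)
    (mayPass : Bool) (first : Player) :
    MakerWins G b mayPass first (gameChromaticIndex G b mayPass first) :=
  Nat.sInf_mem (s := {k : ℕ | MakerWins G b mayPass first k})
    ⟨_, makerWins_card_edgeSet G hb mayPass first⟩

end EdgeColouringGame

/-!
The proof analyses a randomised Maker and then derandomises it. Let `D` be the maximum degree, and
let the *load* of a vertex be the number of coloured edges at it. In each turn the random Maker
picks an endpoint `v` of an edge coloured since his previous decision (his own last edge included),
then a uniformly random uncoloured edge at `v`, and then a uniformly random colour. As his own last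
edge is answered too, every increase of a load is answered with probability at least
`1 / (2 * (b + 1))`, and a passing Breaker needs no special treatment.

*Derandomisation.* For a predicate on moves let `hits` be the number of Maker's moves that satisfy
it, and `drift` the sum of the conditional probabilities that they do. Then
`exp (drift / 2 - hits)` is a supermartingale, so by averaging (`exists_legal_sum_exp_le`) Maker has
a legal move that does not increase a given weighted sum of such terms. If the initial weights
`exp (-ℓ j)` add up to at most `1`, he thereby keeps `drift / 2 - ℓ j ≤ hits` for all the predicates
simultaneously (`drift_div_two_sub_le_hits`). What is left is a deterministic statement on plays
with this property, `Run.exists_available`: no uncoloured edge is ever blocked.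

*Diversity.* Call a vertex young while its load is below `D / 4`. Consider an edge `e` that is still
uncoloured when the first of its endpoints ceases to be young. That endpoint has been answered in
proportion to its load `D / 4`, so the probabilities with which `e` was chosen while both of its
endpoints were young add up to at least `1 / (16 * (b + 1))`
(`Run.le_sum_edgeWeight_of_young`). At such an edge fewer than `D / 2` of the roughly `2 * D` colours
are blocked, whence a fixed set `A` of at most `D` colours is avoided with constant probability. So
every old vertex of large degree gets of the order of `D / b` random colours outside `A` in
expectation. For `ω = 2 ^ 14 * b` old vertices together this exceeds the cost, of order
`D + ω * log v(G)`, of taking all sets `A` and all sets of `ω` vertices into account. Hence fewer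
than `ω` old vertices `w` of large degree have `4 * D / ω` or fewer colours outside `A`
(`Run.card_exceptional_lt`).

*Common colours.* If `uv` is blocked, then both loads are almost `D` and `u`, `v` have very few
common colours. Say `u` is the first of the two to reach load `(1 - 1 / ω) * D`. While the load of
`v` increases from `(1 - 1 / ω) * D` to `(1 - 1 / (2 * ω)) * D`, apply the previous paragraph with
the set `A` of the colours at `u` but not at `v`, which has almost `D` elements: for all but `ω`
uncoloured edges `vw`, at least `2 * D / ω` colours of `A` are missing at `w`, and thus available at
`vw` (`le_hitWeight_gain`). Each answer at `v` therefore creates a common colour of `u` and `v` with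
probability of order `1 / ω`, so that they get of the order of `D / (ω ^ 2 * b)` common colours
(`Run.le_card_inter`), a contradiction.
-/

namespace EdgeColouringGame

open Finset

open scoped Classical

/-! ### Winning strategies from invariants, and averaging -/

/-- Positions described by `PM` (Maker to move) and `PB` (Breaker to move) that Maker can always
maintain give a winning strategy, which moreover depends on the current position only. -/
theorem makerWins_of_invariant {V : Type*} {G : SimpleGraph V} {k b : ℕ} (hb : 1 ≤ b)
    (mayPass : Bool) (first : Player) (PM PB : PartialColouring G k → Prop)
    (hM : PM fun _ => none) (hB : PB fun _ => none)
    (hMaker : ∀ c, PM c → (∃ e, c e = none) → ∃ c', ColoursEdge c c' ∧ PB c')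
    (hBreaker : ∀ c c', PB c → BreakerTurn b mayPass c c' → PM c')
    (hmove : ∀ c, PB c → (∃ e, c e = none) → ∃ c', ColoursEdge c c') :
    MakerWins G b mayPass first k := by
  choose! next hnext hPB using hMaker
  refine ⟨fun h => next (h.headD fun _ => none), ?_⟩
  have key : ∀ p h, Play b mayPass first
      (fun h => next (h.headD fun _ => none) : MakerStrategy G k) p h →
      ∀ c t, h = c :: t → ((p = .maker → PM c) ∧ (p = .breaker → PB c)) ∨ ∀ e, c e ≠ none := by
    intro p h hp
    induction hp with
    | start =>
      rintro c t ⟨⟩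
      exact Or.inl ⟨fun _ => hM, fun _ => hB⟩
    | maker c h hp hc ih =>
      rintro c₁ t ⟨⟩
      obtain ⟨e, i, he, -⟩ := hc
      rcases ih c h rfl with ih | ih
      · exact Or.inl ⟨by simp, fun _ => hPB c (ih.1 rfl) ⟨e, he⟩⟩
      · exact absurd he (ih e)
    | breaker c c' h hp hc ih =>
      rintro c₁ t ⟨⟩
      rcases ih c h rfl with ih | ih
      · exact Or.inl ⟨fun _ => hBreaker c c' (ih.2 rfl) hc, by simp⟩
      · right
        obtain ⟨m, -, -, hm⟩ := hc
        cases m with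
        | zero => cases hm; exact ih
        | succ m => obtain ⟨d, ⟨e, i, he, -⟩, -⟩ := hm; exact absurd he (ih e)
  intro p c h hplay hend e he
  rcases key p _ hplay c h rfl with hk | hk
  · cases p with
    | maker => exact hend ⟨_, _, Play.maker c h hplay (hnext c (hk.1 rfl) ⟨e, he⟩)⟩
    | breaker =>
      obtain ⟨c', hc'⟩ := hmove c (hk.2 rfl) ⟨e, he⟩
      exact hend ⟨_, _, Play.breaker c c' h hplay ⟨1, hb, fun _ => le_rfl, c', hc', rfl⟩⟩
  · exact hk e he

/-- The step of the derandomisation. Here `q` is a subprobability on the legal moves, the missing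
mass going to `m₀`. The new potential on the left is at most the old one in expectation, because
`exp (z / 2) * (1 - (1 - exp (-1)) * z) ≤ 1` for every probability `z`. -/
theorem exists_legal_sum_exp_le {ι M : Type*} [Fintype ι] [Fintype M] (legal : M → Prop)
    (m₀ : M) (hm₀ : legal m₀) (q : M → ℝ) (hq : ∀ m, 0 ≤ q m) (hql : ∀ m, q m ≠ 0 → legal m)
    (hq1 : ∑ m, q m ≤ 1) (S : ι → M → Prop) [∀ j m, Decidable (S j m)]
    (Φ : ι → ℝ) (hΦ : ∀ j, 0 ≤ Φ j) :
    ∃ m, legal m ∧ ∑ j, Φ j * Real.exp ((∑ m', if S j m' then q m' else 0) / 2 -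
      (if S j m then 1 else 0)) ≤ ∑ j, Φ j := by
  let z : ι → ℝ := fun j => ∑ m', if S j m' then q m' else 0
  let F : M → ℝ := fun m => ∑ j, Φ j * Real.exp (z j / 2 - (if S j m then 1 else 0))
  -- a legal move minimising the new potential does at least as well as the random one
  obtain ⟨m₁, hm₁, hmin⟩ := Set.exists_min_image {m | legal m} F (Set.toFinite _) ⟨m₀, hm₀⟩
  refine ⟨m₁, hm₁, ?_⟩
  change F m₁ ≤ _
  have h1 : ∑ m, q m * F m₁ ≤ ∑ m, q m * F m := by
    refine sum_le_sum fun m _ => ?_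
    by_cases h : q m = 0
    · simp [h]
    · exact mul_le_mul_of_nonneg_left (hmin m (hql m h)) (hq m)
  rw [← sum_mul] at h1
  have hz0 : ∀ j, 0 ≤ z j := fun j => sum_nonneg fun m _ => by split_ifs <;> simp [hq]
  have h2 : ∑ m, q m * F m + (1 - ∑ m, q m) * F m₀ ≤ ∑ j, Φ j := by
    have e1 : ∑ m, q m * F m = ∑ j, Φ j * (Real.exp (z j / 2) *
        ∑ m, q m * Real.exp (-(if S j m then 1 else 0))) := by
      simp only [F, mul_sum]
      rw [sum_comm]
      refine sum_congr rfl fun j _ => sum_congr rfl fun m _ => ?_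
      rw [sub_eq_add_neg, Real.exp_add]; ring
    have e2 : (1 - ∑ m, q m) * F m₀ ≤ ∑ j, Φ j * (Real.exp (z j / 2) * (1 - ∑ m, q m)) := by
      simp only [F]
      rw [mul_sum]
      refine sum_le_sum fun j _ => ?_
      have : Real.exp (z j / 2 - (if S j m₀ then 1 else 0)) ≤ Real.exp (z j / 2) := by
        apply Real.exp_le_exp.2
        split_ifs <;> linarith
      calc (1 - ∑ m, q m) * (Φ j * Real.exp (z j / 2 - (if S j m₀ then 1 else 0)))
          = Φ j * (1 - ∑ m, q m) * Real.exp (z j / 2 - (if S j m₀ then 1 else 0)) := by ring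
        _ ≤ Φ j * (1 - ∑ m, q m) * Real.exp (z j / 2) :=
            mul_le_mul_of_nonneg_left this (mul_nonneg (hΦ j) (by linarith))
        _ = _ := by ring
    rw [e1]
    refine (add_le_add_right e2 _).trans ?_
    rw [← sum_add_distrib]
    refine sum_le_sum fun j _ => ?_
    rw [← mul_add, ← mul_add]
    refine mul_le_of_le_one_right (hΦ j) ?_
    -- the expectation of `exp (-1)` to the power of the indicator of `S j`
    have e3 : ∑ m, q m * Real.exp (-(if S j m then 1 else 0)) + (1 - ∑ m, q m)
        = 1 - (1 - Real.exp (-1)) * z j := by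
      have : ∀ m, q m * Real.exp (-(if S j m then 1 else 0))
          = q m - (1 - Real.exp (-1)) * (if S j m then q m else 0) := by
        intro m; split_ifs <;> [ring; simp]
      rw [sum_congr rfl fun m _ => this m, sum_sub_distrib, ← mul_sum]
      ring
    rw [e3]
    have e4 : Real.exp (-1) ≤ 1 / 2 := by
      have := Real.exp_one_gt_d9
      rw [Real.exp_neg, inv_eq_one_div]
      exact one_div_le_one_div_of_le (by norm_num) (by linarith)
    have e5 : 1 - (1 - Real.exp (-1)) * z j ≤ Real.exp (-(z j / 2)) := by
      have := Real.add_one_le_exp (-(z j / 2))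
      nlinarith [hz0 j]
    calc _ ≤ Real.exp (z j / 2) * Real.exp (-(z j / 2)) :=
          mul_le_mul_of_nonneg_left e5 (Real.exp_pos _).le
      _ = 1 := by rw [← Real.exp_add]; simp
  nlinarith [hmin m₀ hm₀]

/-- A discrete intermediate value theorem. -/
theorem exists_lt_le_succ {f : ℕ → ℕ} {θ : ℝ} {r : ℕ} (h0 : (f 0 : ℝ) < θ) (hr : θ ≤ f r) :
    ∃ T < r, (f T : ℝ) < θ ∧ θ ≤ f (T + 1) := by
  induction r with
  | zero => linarith
  | succ r ih =>
    by_cases h : (f r : ℝ) < θ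
    · exact ⟨r, by omega, h, hr⟩
    · obtain ⟨T, hT, h'⟩ := ih (not_lt.1 h)
      exact ⟨T, by omega, h'⟩

/-! ### Loads and colours at a vertex -/

section Positions

variable {V : Type*} {G : SimpleGraph V} {k : ℕ}

/-- `c'` keeps the colours of `c`. -/
def Extends (c c' : PartialColouring G k) : Prop :=
  ∀ e, c e ≠ none → c' e = c e

/-- Adjacent edges have different colours. -/
def Proper (c : PartialColouring G k) : Prop :=
  ∀ e f i, AdjacentEdges e f → c e = some i → c f ≠ some i

theorem Extends.refl (c : PartialColouring G k) : Extends c c := fun _ _ => rfl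

theorem Extends.trans {c d e : PartialColouring G k} (h : Extends c d) (h' : Extends d e) :
    Extends c e := fun x hx => by
  rw [h' x (by rwa [h x hx]), h x hx]

theorem Extends.eq_none {c d : PartialColouring G k} (h : Extends c d) {e : G.edgeSet}
    (he : d e = none) : c e = none := by
  by_contra hc
  exact hc (by rw [← h e hc, he])

theorem Extends.eq_some {c d : PartialColouring G k} (h : Extends c d) {e : G.edgeSet}
    {i : Fin k} (he : c e = some i) : d e = some i := by
  rw [h e (by simp [he]), he]

theorem Proper.of_extends {c d : PartialColouring G k} (hd : Proper d) (h : Extends c d) :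
    Proper c := fun e f i hef he hf => hd e f i hef (h.eq_some he) (h.eq_some hf)

theorem ColoursEdge.extends {c d : PartialColouring G k} (h : ColoursEdge c d) :
    Extends c d := by
  obtain ⟨e, i, he, -, rfl⟩ := h
  intro f hf
  have : f ≠ e := by rintro rfl; exact hf he
  simp [this]

theorem ColoursEdge.proper {c d : PartialColouring G k} (h : ColoursEdge c d) (hc : Proper c) :
    Proper d := by
  obtain ⟨e, i, he, hav, rfl⟩ := h
  intro f g j hfg hf hg
  by_cases hfe : f = e
  · subst hfe
    have hgf : g ≠ f := hfg.1.symm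
    simp only [Function.update_self, Option.some.injEq] at hf
    subst hf
    rw [Function.update_of_ne hgf] at hg
    exact hav g hfg hg
  · rw [Function.update_of_ne hfe] at hf
    by_cases hge : g = e
    · subst hge
      simp only [Function.update_self, Option.some.injEq] at hg
      subst hg
      obtain ⟨hne, v, hv, hv'⟩ := hfg
      exact hav f ⟨hne.symm, v, hv', hv⟩ hf
    · rw [Function.update_of_ne hge] at hg
      exact hc f g j hfg hf hg

variable [Fintype V]

variable (G) in
/-- The edges of `G` at the vertex `v`. -/
noncomputable def edgesAt (v : V) : Finset G.edgeSet :=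
  univ.filter fun e => v ∈ (e : Sym2 V)

/-- The uncoloured edges at `v`. -/
noncomputable def freeAt (c : PartialColouring G k) (v : V) : Finset G.edgeSet :=
  (edgesAt G v).filter fun e => c e = none

/-- The load of `v`: the number of coloured edges at `v`. -/
noncomputable def load (c : PartialColouring G k) (v : V) : ℕ :=
  #((edgesAt G v).filter fun e => c e ≠ none)

/-- The colours that occur at `v`. -/
noncomputable def coloursAt (c : PartialColouring G k) (v : V) : Finset (Fin k) :=
  univ.filter fun i => ∃ e : G.edgeSet, v ∈ (e : Sym2 V) ∧ c e = some i

/-- The edges that are coloured in `c'` but not in `c`. -/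
noncomputable def newEdges (c c' : PartialColouring G k) : Finset G.edgeSet :=
  univ.filter fun e => c e = none ∧ c' e ≠ none

theorem mem_edgesAt {v : V} {e : G.edgeSet} : e ∈ edgesAt G v ↔ v ∈ (e : Sym2 V) := by
  simp [edgesAt]

theorem mem_freeAt {c : PartialColouring G k} {v : V} {e : G.edgeSet} :
    e ∈ freeAt c v ↔ v ∈ (e : Sym2 V) ∧ c e = none := by
  simp [freeAt, edgesAt]

theorem mem_coloursAt {c : PartialColouring G k} {v : V} {i : Fin k} :
    i ∈ coloursAt c v ↔ ∃ e : G.edgeSet, v ∈ (e : Sym2 V) ∧ c e = some i := by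
  simp [coloursAt]

theorem card_freeAt_add_load (c : PartialColouring G k) (v : V) :
    #(freeAt c v) + load c v = #(edgesAt G v) :=
  card_filter_add_card_filter_not _

theorem load_mono {c d : PartialColouring G k} (h : Extends c d) (v : V) :
    load c v ≤ load d v :=
  card_le_card fun e he => by
    simp only [mem_filter] at he ⊢
    exact ⟨he.1, fun hd => he.2 (h.eq_none hd)⟩

theorem coloursAt_mono {c d : PartialColouring G k} (h : Extends c d) (v : V) :
    coloursAt c v ⊆ coloursAt d v := fun i hi => by
  rw [mem_coloursAt] at hi ⊢
  obtain ⟨e, he, hc⟩ := hi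
  exact ⟨e, he, h.eq_some hc⟩

theorem card_coloursAt_le_load (c : PartialColouring G k) (v : V) :
    #(coloursAt c v) ≤ load c v := by
  have h : (coloursAt c v).image some ⊆ ((edgesAt G v).filter fun e => c e ≠ none).image c := by
    intro o ho
    simp only [mem_image, mem_coloursAt, mem_filter, mem_edgesAt] at ho ⊢
    obtain ⟨i, ⟨e, he, hc⟩, rfl⟩ := ho
    exact ⟨e, ⟨he, by simp [hc]⟩, hc⟩
  have h' := card_le_card h
  rw [card_image_of_injective _ (Option.some_injective _)] at h'
  exact h'.trans card_image_le

theorem Proper.load_le_card_coloursAt {c : PartialColouring G k} (hc : Proper c) (v : V) :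
    load c v ≤ #(coloursAt c v) := by
  have h : ((edgesAt G v).filter fun e => c e ≠ none).image c ⊆ (coloursAt c v).image some := by
    intro o ho
    simp only [mem_image, mem_coloursAt, mem_filter, mem_edgesAt] at ho ⊢
    obtain ⟨e, ⟨he, hce⟩, rfl⟩ := ho
    obtain ⟨i, hi⟩ := Option.ne_none_iff_exists'.1 hce
    exact ⟨i, ⟨e, he, hi⟩, hi.symm⟩
  have h' := card_le_card h
  rw [card_image_of_injective _ (Option.some_injective _), card_image_of_injOn] at h'
  · exact h'
  · intro e he f hf hef
    simp only [coe_filter, Set.mem_ofPred_eq, mem_edgesAt] at he hf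
    by_contra hne
    obtain ⟨i, hi⟩ := Option.ne_none_iff_exists'.1 he.2
    exact hc e f i ⟨hne, v, he.1, hf.1⟩ hi (hef ▸ hi)

theorem load_le_add_card_filter (c d : PartialColouring G k) (v : V) :
    load d v ≤ load c v + #((newEdges c d).filter fun e : G.edgeSet => v ∈ (e : Sym2 V)) := by
  refine le_trans (card_le_card ?_) (card_union_le _ _)
  intro e he
  simp only [mem_filter, mem_union, mem_edgesAt, newEdges, mem_univ, true_and] at he ⊢
  by_cases h : c e = none
  · exact Or.inr ⟨⟨h, he.2⟩, he.1⟩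
  · exact Or.inl ⟨he.1, h⟩

theorem load_le_add_card_newEdges (c d : PartialColouring G k) (v : V) :
    load d v ≤ load c v + #(newEdges c d) :=
  (load_le_add_card_filter c d v).trans (Nat.add_le_add_left (card_filter_le _ _) _)

theorem card_newEdges_le_add (c d e : PartialColouring G k) :
    #(newEdges c e) ≤ #(newEdges c d) + #(newEdges d e) := by
  refine le_trans (card_le_card ?_) (card_union_le _ _)
  intro x hx
  simp only [mem_filter, mem_union, newEdges, mem_univ, true_and] at hx ⊢
  by_cases h : d x = none
  · exact Or.inr ⟨h, hx.2⟩
  · exact Or.inl ⟨hx.1, h⟩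

theorem newEdges_self (c : PartialColouring G k) : newEdges c c = ∅ := by
  ext e; simp [newEdges]

theorem card_endpoints (e : G.edgeSet) : #(univ.filter fun v => v ∈ (e : Sym2 V)) = 2 := by
  obtain ⟨e, he⟩ := e
  induction e using Sym2.ind with
  | _ x y =>
    have hxy : x ≠ y := G.ne_of_adj he
    have : (univ.filter fun v => v ∈ (s(x, y) : Sym2 V)) = {x, y} := by ext; simp
    rw [this, card_pair hxy]

theorem sum_load_sub_le (c d : PartialColouring G k) :
    ∑ v, ((load d v : ℝ) - load c v) ≤ 2 * #(newEdges c d) := by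
  have h1 : ∀ v, (load d v : ℝ) - load c v ≤
      ∑ e ∈ newEdges c d, if v ∈ (e : Sym2 V) then (1 : ℝ) else 0 := by
    intro v
    have := load_le_add_card_filter c d v
    rw [sum_boole, sub_le_iff_le_add']
    exact_mod_cast this
  refine (sum_le_sum fun v _ => h1 v).trans ?_
  rw [sum_comm]
  simp only [sum_boole, card_endpoints]
  simp [mul_comm]

/-- The number of edges at `v` with an endpoint other than `v` in `B` is at most `#B`. -/
theorem card_filter_exists_endpoint_le (s : Finset G.edgeSet) (v : V) (hs : s ⊆ edgesAt G v)
    (B : Finset V) :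
    #(s.filter fun e : G.edgeSet => ∃ w ∈ B, w ≠ v ∧ w ∈ (e : Sym2 V)) ≤ #B := by
  have h : (s.filter fun e : G.edgeSet => ∃ w ∈ B, w ≠ v ∧ w ∈ (e : Sym2 V)) ⊆
      B.biUnion fun w => s.filter fun e : G.edgeSet => w ≠ v ∧ w ∈ (e : Sym2 V) := by
    intro e he
    simp only [mem_filter, mem_biUnion] at he ⊢
    obtain ⟨he, w, hw, h⟩ := he
    exact ⟨w, hw, he, h⟩
  refine (card_le_card h).trans ((card_biUnion_le_card_mul _ _ 1 fun w _ => ?_).trans (by simp))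
  rw [card_le_one]
  intro e he f hf
  simp only [mem_filter] at he hf
  have hev := mem_edgesAt.1 (hs he.1)
  have hfv := mem_edgesAt.1 (hs hf.1)
  exact Subtype.ext (Sym2.eq_of_ne_mem he.2.1 he.2.2 hev hf.2.2 hfv)

theorem ColoursEdge.card_newEdges_le {c d : PartialColouring G k} (h : ColoursEdge c d) :
    #(newEdges c d) ≤ 1 := by
  obtain ⟨e, i, he, -, rfl⟩ := h
  have : newEdges c (Function.update c e (some i)) ⊆ {e} := by
    intro f hf
    simp only [newEdges, mem_filter, mem_univ, true_and, mem_singleton] at hf ⊢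
    by_contra hne
    simp [hne, hf.1] at hf
  exact (card_le_card this).trans (by simp)

theorem ColoursEdges.extends_and {m : ℕ} {c d : PartialColouring G k} (h : ColoursEdges m c d)
    (hc : Proper c) : Extends c d ∧ #(newEdges c d) ≤ m ∧ Proper d := by
  induction m generalizing c with
  | zero =>
    cases h
    exact ⟨.refl _, by simp [newEdges_self], hc⟩
  | succ m ih =>
    obtain ⟨e, he, h⟩ := h
    obtain ⟨h1, h2, h3⟩ := ih h (he.proper hc)
    refine ⟨he.extends.trans h1, ?_, h3⟩
    have := card_newEdges_le_add c e d
    have := he.card_newEdges_le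
    omega

end Positions

/-! ### The random move of Maker -/

section Weights

variable {V : Type*} {G : SimpleGraph V} {k : ℕ}

/-- The move that gives the edge `m.1` the colour `m.2` is legal at `c`. -/
def Legal (c : PartialColouring G k) (m : G.edgeSet × Fin k) : Prop :=
  c m.1 = none ∧ Available c m.1 m.2

variable [Fintype V]

/-- The probability with which a given uncoloured edge at `v` is chosen in answer to the edges at
`v` that are coloured in `c` but not in `d`: each endpoint of each of the at most `b + 1` new edges
is answered with probability `1 / (2 * (b + 1))`, by a uniformly random uncoloured edge. The value
is `0` if no edge at `v` is uncoloured. -/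
noncomputable def rate (b : ℕ) (d c : PartialColouring G k) (v : V) : ℝ :=
  ((load c v : ℝ) - load d v) / (2 * (b + 1) * #(freeAt c v))

/-- The probability with which the random Maker chooses the uncoloured edge `e` at the position `c`,
where `d` is the position at his previous decision. -/
noncomputable def edgeWeight (b : ℕ) (d c : PartialColouring G k) (e : G.edgeSet) : ℝ :=
  ∑ v with v ∈ (e : Sym2 V), rate b d c v

/-- The probability of a move of the random Maker. All `k` colours are equally likely, and illegal
choices are discarded, so that these numbers only form a subprobability. -/
noncomputable def moveWeight (b : ℕ) (d c : PartialColouring G k) (m : G.edgeSet × Fin k) : ℝ :=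
  if Legal c m then edgeWeight b d c m.1 / k else 0

/-- The probability that the move of the random Maker satisfies `S`. -/
noncomputable def hitWeight (b : ℕ) (d c : PartialColouring G k)
    (S : G.edgeSet × Fin k → Prop) : ℝ :=
  ∑ m, if S m then moveWeight b d c m else 0

variable {b : ℕ} {d c : PartialColouring G k}

theorem rate_nonneg (h : Extends d c) (v : V) : 0 ≤ rate b d c v := by
  have : (load d v : ℝ) ≤ load c v := by exact_mod_cast load_mono h v
  exact div_nonneg (by linarith) (by positivity)

theorem rate_le_edgeWeight (h : Extends d c) {v : V} {e : G.edgeSet} (hv : v ∈ (e : Sym2 V)) :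
    rate b d c v ≤ edgeWeight b d c e :=
  single_le_sum (f := rate b d c) (fun v _ => rate_nonneg h v) (by simpa using hv)

theorem edgeWeight_nonneg (h : Extends d c) (e : G.edgeSet) : 0 ≤ edgeWeight b d c e :=
  sum_nonneg fun v _ => rate_nonneg h v

theorem moveWeight_nonneg (h : Extends d c) (m : G.edgeSet × Fin k) : 0 ≤ moveWeight b d c m := by
  unfold moveWeight
  split_ifs
  · exact div_nonneg (edgeWeight_nonneg h _) (by positivity)
  · exact le_rfl

theorem sum_moveWeight_le_one (h : Extends d c) (hn : #(newEdges d c) ≤ b + 1) :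
    ∑ m, moveWeight b d c m ≤ 1 := by
  have h1 : ∀ e : G.edgeSet, ∑ i, moveWeight b d c (e, i) ≤
      if c e = none then edgeWeight b d c e else 0 := by
    intro e
    by_cases hc : c e = none
    · rw [if_pos hc]
      have : ∀ i : Fin k, moveWeight b d c (e, i) ≤ edgeWeight b d c e / k := fun i => by
        unfold moveWeight
        split_ifs
        · exact le_rfl
        · exact div_nonneg (edgeWeight_nonneg h _) (by positivity)
      refine (sum_le_sum fun i _ => this i).trans ?_
      rw [sum_const, card_univ, Fintype.card_fin, nsmul_eq_mul]
      rcases Nat.eq_zero_or_pos k with rfl | hk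
      · simpa using edgeWeight_nonneg h e
      · rw [mul_div_cancel₀ _ (by positivity)]
    · simp [moveWeight, Legal, hc]
  have h2 : ∑ e : G.edgeSet, (if c e = none then edgeWeight b d c e else 0) =
      ∑ v, #(freeAt c v) * rate b d c v := by
    have : ∀ e : G.edgeSet, (if c e = none then edgeWeight b d c e else 0) =
        ∑ v, if e ∈ freeAt c v then rate b d c v else 0 := by
      intro e
      simp only [edgeWeight, mem_freeAt, sum_filter]
      split_ifs with hc <;> simp [hc]
    rw [sum_congr rfl fun e _ => this e, sum_comm]
    refine sum_congr rfl fun v _ => ?_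
    rw [← sum_filter, sum_const, nsmul_eq_mul]
    simp
  have hb : (0 : ℝ) < 2 * (b + 1) := by positivity
  have h3 : ∀ v, #(freeAt c v) * rate b d c v ≤ ((load c v : ℝ) - load d v) / (2 * (b + 1)) := by
    intro v
    have hl : (load d v : ℝ) ≤ load c v := by exact_mod_cast load_mono h v
    rcases Nat.eq_zero_or_pos #(freeAt c v) with h0 | h0
    · rw [h0]
      simpa using div_nonneg (by linarith) hb.le
    · have : (0 : ℝ) < #(freeAt c v) := by exact_mod_cast h0
      unfold rate
      apply le_of_eq
      field_simp
  rw [Fintype.sum_prod_type]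
  refine (sum_le_sum fun e _ => h1 e).trans ?_
  rw [h2]
  refine (sum_le_sum fun v _ => h3 v).trans ?_
  rw [← sum_div, div_le_one hb]
  have hn' : (#(newEdges d c) : ℝ) ≤ b + 1 := by exact_mod_cast hn
  linarith [sum_load_sub_le d c]

/-- If each edge of `T` can be coloured with a proportion `α` of the colours so as to satisfy `S`,
then `S` has at least `α` times the probability of choosing an edge of `T`. -/
theorem le_hitWeight (h : Extends d c) (hk : 0 < k) {S : G.edgeSet × Fin k → Prop} {α : ℝ}
    (T : Finset G.edgeSet) (I : G.edgeSet → Finset (Fin k)) (hT : ∀ e ∈ T, c e = none)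
    (hI : ∀ e ∈ T, ∀ i ∈ I e, Available c e i ∧ S (e, i))
    (hα : ∀ e ∈ T, α * k ≤ #(I e)) :
    α * ∑ e ∈ T, edgeWeight b d c e ≤ hitWeight b d c S := by
  have hk' : (0 : ℝ) < k := by exact_mod_cast hk
  have hnn : ∀ m, 0 ≤ if S m then moveWeight b d c m else 0 := fun m => by
    split_ifs
    · exact moveWeight_nonneg h m
    · exact le_rfl
  unfold hitWeight
  rw [Fintype.sum_prod_type, mul_sum]
  refine le_trans ?_ (sum_le_univ_sum_of_nonneg (s := T) fun e =>
    sum_nonneg fun i _ => hnn (e, i))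
  refine sum_le_sum fun e he => ?_
  refine le_trans ?_ (sum_le_univ_sum_of_nonneg (s := I e) fun i => hnn (e, i))
  rw [sum_congr rfl fun i hi => by
    rw [if_pos (hI e he i hi).2, moveWeight, if_pos ⟨hT e he, (hI e he i hi).1⟩]]
  rw [sum_const (edgeWeight b d c e / (k : ℝ)), nsmul_eq_mul, mul_div_assoc', le_div_iff₀ hk']
  nlinarith [hα e he, edgeWeight_nonneg (b := b) h e]

end Weights

/-! ### Runs of the game -/

section Runs

variable {V : Type*} [Fintype V] {G : SimpleGraph V} {k : ℕ}

/-- The record of a play in which Maker has moved `R` times. `c (r + 1)` is the position at which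
Maker chooses the move `m r`, for `r < R`, and `c (R + 1)` is the current position, no matter whose
turn it is. `c 0` is a dummy decision at the start. Hence at most `b + 1` edges are new in
`c (r + 1)` compared to `c r`: Maker's last edge and those of the Breaker turn after it. -/
structure Run (b R : ℕ) (c : ℕ → PartialColouring G k) (m : ℕ → G.edgeSet × Fin k) : Prop where
  start : c 0 = fun _ => none
  ext_succ : ∀ r ≤ R, Extends (c r) (c (r + 1))
  few : ∀ r ≤ R, #(newEdges (c r) (c (r + 1))) ≤ b + 1
  legal : ∀ r < R, Legal (c (r + 1)) (m r)
  played : ∀ r < R, c (r + 2) (m r).1 = some (m r).2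
  proper : Proper (c (R + 1))

/-- The number of Maker's first `R` moves that satisfy `S` at the position they are made. -/
noncomputable def hits (S : PartialColouring G k → G.edgeSet × Fin k → Prop)
    (c : ℕ → PartialColouring G k) (m : ℕ → G.edgeSet × Fin k) (R : ℕ) : ℕ :=
  #{r ∈ range R | S (c (r + 1)) (m r)}

/-- The sum of the conditional probabilities that Maker's first `R` moves satisfy `S`. -/
noncomputable def drift (b : ℕ) (S : PartialColouring G k → G.edgeSet × Fin k → Prop)
    (c : ℕ → PartialColouring G k) (R : ℕ) : ℝ :=
  ∑ r ∈ range R, hitWeight b (c r) (c (r + 1)) (S (c (r + 1)))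

variable {b R : ℕ} {c : ℕ → PartialColouring G k} {m : ℕ → G.edgeSet × Fin k}

theorem Run.ext (h : Run b R c m) {r s : ℕ} (hrs : r ≤ s) (hs : s ≤ R + 1) :
    Extends (c r) (c s) := by
  induction s, hrs using Nat.le_induction with
  | base => exact .refl _
  | succ s hrs ih => exact (ih (by omega)).trans (h.ext_succ s (by omega))

theorem Run.load_mono (h : Run b R c m) {r s : ℕ} (hrs : r ≤ s) (hs : s ≤ R + 1) (v : V) :
    load (c r) v ≤ load (c s) v :=
  EdgeColouringGame.load_mono (h.ext hrs hs) v

theorem Run.load_succ_le (h : Run b R c m) {r : ℕ} (hr : r ≤ R) (v : V) :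
    load (c (r + 1)) v ≤ load (c r) v + (b + 1) :=
  (load_le_add_card_newEdges _ _ v).trans (Nat.add_le_add_left (h.few r hr) _)

theorem Run.load_zero (h : Run b R c m) (v : V) : load (c 0) v = 0 := by
  simp [load, h.start]

theorem Run.truncate (h : Run b R c m) {r : ℕ} (hr : r ≤ R) : Run b r c m where
  start := h.start
  ext_succ s hs := h.ext_succ s (hs.trans hr)
  few s hs := h.few s (hs.trans hr)
  legal s hs := h.legal s (hs.trans_le hr)
  played s hs := h.played s (hs.trans_le hr)
  proper := h.proper.of_extends (h.ext (by omega) le_rfl)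

theorem Run.final_eq (h : Run b R c m) {r : ℕ} (hr : r < R) :
    c (R + 1) (m r).1 = some (m r).2 :=
  (h.ext (show r + 2 ≤ R + 1 by omega) le_rfl).eq_some (h.played r hr)

theorem Run.move_injOn (h : Run b R c m) : Set.InjOn (fun r => (m r).1) (Set.Iio R) := by
  have key : ∀ r s, r < s → s < R → (m r).1 ≠ (m s).1 := by
    intro r s hrs hs heq
    have h1 := (h.ext (show r + 2 ≤ s + 1 by omega) (by omega)).eq_some (h.played r (by omega))
    have h2 := (h.legal s hs).1
    rw [← heq, h1] at h2
    cases h2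
  intro r hr s hs heq
  rcases lt_trichotomy r s with h' | h' | h'
  · exact absurd heq (key r s h' hs)
  · exact h'
  · exact absurd heq.symm (key s r h' hr)

/-- If every hit puts a colour of `I` on an edge that meets `W`, then the hits are counted by the
colours of `I` at the vertices of `W`, as the colouring is proper. -/
theorem Run.hits_le (h : Run b R c m) (S : PartialColouring G k → G.edgeSet × Fin k → Prop)
    (W : Finset V) (I : Finset (Fin k))
    (hS : ∀ r < R, S (c (r + 1)) (m r) → (m r).2 ∈ I ∧ ∃ w ∈ W, w ∈ ((m r).1 : Sym2 V)) :
    hits S c m R ≤ ∑ w ∈ W, #(coloursAt (c (R + 1)) w ∩ I) := by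
  have hS' : ∀ r, ∃ w, r < R → S (c (r + 1)) (m r) →
      (m r).2 ∈ I ∧ w ∈ W ∧ w ∈ ((m r).1 : Sym2 V) := by
    intro r
    by_cases hr : r < R ∧ S (c (r + 1)) (m r)
    · obtain ⟨h1, w, hw⟩ := hS r hr.1 hr.2
      exact ⟨w, fun _ _ => ⟨h1, hw⟩⟩
    · exact ⟨((m r).1 : Sym2 V).out.1, fun h1 h2 => absurd ⟨h1, h2⟩ hr⟩
  choose w hw using hS'
  rw [← card_sigma]
  refine card_le_card_of_injOn (fun r => ⟨w r, (m r).2⟩) ?_ ?_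
  · intro r hr
    simp only [coe_filter, mem_range, Set.mem_ofPred_eq] at hr
    obtain ⟨h1, h2, h3⟩ := hw r hr.1 hr.2
    simp only [coe_sigma, Set.mem_sigma_iff, mem_coe, mem_inter, mem_coloursAt]
    exact ⟨h2, ⟨_, h3, h.final_eq hr.1⟩, h1⟩
  · intro r hr s hs hrs
    simp only [coe_filter, mem_range, Set.mem_ofPred_eq] at hr hs
    simp only [Sigma.mk.injEq, heq_eq_eq] at hrs
    by_contra hne
    have hm : (m r).1 ≠ (m s).1 := fun h' => hne (h.move_injOn hr.1 hs.1 h')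
    have h1 := (hw r hr.1 hr.2).2.2
    have h2 := (hw s hs.1 hs.2).2.2
    rw [← hrs.1] at h2
    exact h.proper _ _ _ ⟨hm, _, h1, h2⟩ (h.final_eq hr.1) (hrs.2 ▸ h.final_eq hs.1)

end Runs

/-! ### Young edges and the diversity of colours -/

section Young

variable {V : Type*} [Fintype V] {G : SimpleGraph V} {k : ℕ}

/-- Both endpoints of `e` are young: their load is less than `D / 4`. -/
def Young (D : ℕ) (c : PartialColouring G k) (e : G.edgeSet) : Prop :=
  ∀ v ∈ (e : Sym2 V), 4 * load c v < D

/-- The move colours a young edge that meets `W`, with a colour outside `A`. -/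
def YoungAvoiding (D : ℕ) (W : Finset V) (A : Finset (Fin k)) (c : PartialColouring G k)
    (m : G.edgeSet × Fin k) : Prop :=
  m.2 ∈ Aᶜ ∧ Young D c m.1 ∧ ∃ w ∈ W, w ∈ (m.1 : Sym2 V)

variable {b R D : ℕ} {c : ℕ → PartialColouring G k} {m : ℕ → G.edgeSet × Fin k}

/-- As long as an edge at `x` is uncoloured, its total probability of being chosen in answer to
`x` is proportional to the increase of the load of `x`. -/
theorem Run.load_div_le_sum_rate (h : Run b R c m) (hD : ∀ v, #(edgesAt G v) ≤ D)
    (x : V) {r s : ℕ} (hrs : r ≤ s) (hs : s ≤ R) (hfree : (freeAt (c s) x).Nonempty) :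
    ((load (c s) x : ℝ) - load (c r) x) / (2 * (b + 1) * D) ≤
      ∑ t ∈ Ico r s, rate b (c t) (c (t + 1)) x := by
  rw [← sum_Ico_sub (fun t => (load (c t) x : ℝ)) hrs, sum_div]
  refine sum_le_sum fun t ht => ?_
  have ht := mem_Ico.1 ht
  have h1 : (0 : ℝ) ≤ load (c (t + 1)) x - load (c t) x := by
    have := h.load_mono (show t ≤ t + 1 by omega) (by omega) x
    rw [sub_nonneg]
    exact_mod_cast this
  have h2 : 0 < #(freeAt (c (t + 1)) x) := by
    obtain ⟨e, he⟩ := hfree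
    rw [mem_freeAt] at he
    exact card_pos.2 ⟨e, mem_freeAt.2
      ⟨he.1, (h.ext (show t + 1 ≤ s by omega) (by omega)).eq_none he.2⟩⟩
  have h3 : #(freeAt (c (t + 1)) x) ≤ D := (card_filter_le _ _).trans (hD x)
  have h2' : (0 : ℝ) < #(freeAt (c (t + 1)) x) := by exact_mod_cast h2
  have h3' : (#(freeAt (c (t + 1)) x) : ℝ) ≤ D := by exact_mod_cast h3
  unfold rate
  gcongr

/-- An edge that stays uncoloured as long as its endpoint `u` is young has been chosen, while both
of its endpoints were young, with total probability at least `1 / (16 * (b + 1))`: the first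
endpoint to become old has been answered in proportion to its load. -/
theorem Run.le_sum_edgeWeight_of_young (h : Run b R c m) (hD : ∀ v, #(edgesAt G v) ≤ D)
    (hbD : 8 * (b + 1) ≤ D) {u : V} {e : G.edgeSet} (hu : u ∈ (e : Sym2 V))
    (hold : D ≤ 4 * load (c (R + 1)) u)
    (hfree : ∀ T ≤ R, 4 * load (c T) u < D → c T e = none) :
    1 / (16 * ((b : ℝ) + 1)) ≤ ∑ r ∈ range R,
      if c (r + 1) e = none ∧ Young D (c (r + 1)) e then edgeWeight b (c r) (c (r + 1)) e
      else 0 := by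
  have hD0 : (0 : ℝ) < D := by
    have : 0 < D := by omega
    exact_mod_cast this
  set P : Finset V := univ.filter fun v => v ∈ (e : Sym2 V) with hP
  set f : ℕ → ℕ := fun s => P.sup (load (c s)) with hf
  have huP : u ∈ P := by simpa [hP] using hu
  have h0 : (f 0 : ℝ) < D / 4 := by
    have : f 0 = 0 := by
      simp only [hf, ← Nat.bot_eq_zero, Finset.sup_eq_bot_iff]
      intro x _
      exact h.load_zero x
    rw [this]
    simp only [Nat.cast_zero]
    positivity
  have h1 : (D / 4 : ℝ) ≤ f (R + 1) := by
    have h2 : load (c (R + 1)) u ≤ f (R + 1) := Finset.le_sup (f := load (c (R + 1))) huP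
    have h3 : (D : ℝ) ≤ 4 * load (c (R + 1)) u := by exact_mod_cast hold
    have h4 : (load (c (R + 1)) u : ℝ) ≤ f (R + 1) := by exact_mod_cast h2
    linarith
  -- `T` is the last time at which both endpoints are young
  obtain ⟨T, hTR, hT1, hT2⟩ := exists_lt_le_succ h0 h1
  have hTR : T ≤ R := by omega
  have hyoung : ∀ v ∈ (e : Sym2 V), 4 * load (c T) v < D := by
    intro v hv
    have h2 : load (c T) v ≤ f T := Finset.le_sup (f := load (c T)) (by simpa [hP] using hv)
    have h3 : (load (c T) v : ℝ) ≤ f T := by exact_mod_cast h2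
    have : (4 * load (c T) v : ℝ) < D := by linarith
    exact_mod_cast this
  obtain ⟨x, hxP, hx⟩ := Finset.exists_mem_eq_sup P ⟨u, huP⟩ (load (c (T + 1)))
  have hxe : x ∈ (e : Sym2 V) := by simpa [hP] using hxP
  have hTe : c T e = none := hfree T hTR (hyoung u hu)
  have hload : (D : ℝ) / 8 ≤ load (c T) x := by
    have h2 := h.load_succ_le hTR x
    have h3 : (load (c (T + 1)) x : ℝ) ≤ load (c T) x + (b + 1) := by exact_mod_cast h2
    have h4 : (f (T + 1) : ℝ) = load (c (T + 1)) x := by exact_mod_cast hx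
    have h5 : (8 * ((b : ℝ) + 1)) ≤ D := by exact_mod_cast hbD
    linarith
  have hsum := h.load_div_le_sum_rate hD x (Nat.zero_le T) hTR ⟨e, mem_freeAt.2 ⟨hxe, hTe⟩⟩
  rw [h.load_zero x, Nat.cast_zero, sub_zero] at hsum
  calc 1 / (16 * ((b : ℝ) + 1)) = D / 8 / (2 * (b + 1) * D) := by field_simp; norm_num
    _ ≤ load (c T) x / (2 * (b + 1) * D) := by gcongr
    _ ≤ ∑ t ∈ Ico 0 T, rate b (c t) (c (t + 1)) x := hsum
    _ ≤ ∑ t ∈ Ico 0 T, if c (t + 1) e = none ∧ Young D (c (t + 1)) e then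
          edgeWeight b (c t) (c (t + 1)) e else 0 := by
        refine sum_le_sum fun t ht => ?_
        have ht := mem_Ico.1 ht
        rw [if_pos]
        · exact rate_le_edgeWeight (h.ext_succ t (by omega)) hxe
        · refine ⟨(h.ext (show t + 1 ≤ T by omega) (by omega)).eq_none hTe, fun v hv => ?_⟩
          have := h.load_mono (show t + 1 ≤ T by omega) (by omega) v
          have := hyoung v hv
          omega
    _ ≤ _ := by
        refine sum_le_sum_of_subset_of_nonneg (fun t ht => ?_) fun t ht _ => ?_
        · simp only [mem_Ico, mem_range] at ht ⊢; omega
        · split_ifs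
          · exact edgeWeight_nonneg (h.ext_succ t (by simp only [mem_range] at ht; omega)) e
          · exact le_rfl

/-- The uncoloured edges at `u` with both endpoints young. -/
noncomputable def youngAt (D : ℕ) (c : PartialColouring G k) (u : V) : Finset G.edgeSet :=
  (freeAt c u).filter fun e => Young D c e

/-- An old vertex `u` of large degree has been an endpoint of the chosen edge, at times when this
edge was young, with total probability of order `D / b`. -/
theorem Run.le_sum_youngAt (h : Run b R c m) (hD : ∀ v, #(edgesAt G v) ≤ D)
    (hbD : 8 * (b + 1) ≤ D) {u : V} (hdeg : 3 * D ≤ 4 * #(edgesAt G u))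
    (hold : D ≤ 4 * load (c (R + 1)) u) :
    D / (32 * ((b : ℝ) + 1)) ≤ ∑ r ∈ range R, ∑ e ∈ youngAt D (c (r + 1)) u,
      edgeWeight b (c r) (c (r + 1)) e := by
  have hD0 : (0 : ℝ) < D := by
    have : 0 < D := by omega
    exact_mod_cast this
  obtain ⟨T, hTR, hT1, hT2⟩ := exists_lt_le_succ (f := fun s => load (c s) u) (θ := D / 4)
    (r := R + 1) (by rw [h.load_zero]; simp only [Nat.cast_zero]; positivity)
    (by have : (D : ℝ) ≤ 4 * load (c (R + 1)) u := by exact_mod_cast hold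
        linarith)
  have hTR : T ≤ R := by omega
  have hT3 : 4 * load (c T) u < D := by
    have : (4 * load (c T) u : ℝ) < D := by linarith
    exact_mod_cast this
  have hT4 : D ≤ 4 * load (c (T + 1)) u := by
    have : (D : ℝ) ≤ 4 * load (c (T + 1)) u := by linarith
    exact_mod_cast this
  have hcard : (D : ℝ) / 2 ≤ #(freeAt (c T) u) := by
    have := card_freeAt_add_load (c T) u
    have : D ≤ 2 * #(freeAt (c T) u) := by omega
    have : (D : ℝ) ≤ 2 * #(freeAt (c T) u) := by exact_mod_cast this
    linarith
  calc D / (32 * ((b : ℝ) + 1)) = D / 2 * (1 / (16 * ((b : ℝ) + 1))) := by field_simp; norm_num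
    _ ≤ #(freeAt (c T) u) * (1 / (16 * ((b : ℝ) + 1))) := by gcongr
    _ = ∑ e ∈ freeAt (c T) u, 1 / (16 * ((b : ℝ) + 1)) := by rw [sum_const, nsmul_eq_mul]
    _ ≤ ∑ e ∈ freeAt (c T) u, ∑ r ∈ range R,
          if c (r + 1) e = none ∧ Young D (c (r + 1)) e then edgeWeight b (c r) (c (r + 1)) e
          else 0 := by
        refine sum_le_sum fun e he => ?_
        rw [mem_freeAt] at he
        refine h.le_sum_edgeWeight_of_young hD hbD he.1 hold fun S hS hSu => ?_
        have hST : S ≤ T := by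
          by_contra hlt
          have := h.load_mono (show T + 1 ≤ S by omega) (by omega) u
          omega
        exact (h.ext hST (by omega)).eq_none he.2
    _ = ∑ r ∈ range R, ∑ e ∈ freeAt (c T) u,
          if c (r + 1) e = none ∧ Young D (c (r + 1)) e then edgeWeight b (c r) (c (r + 1)) e
          else 0 := sum_comm
    _ ≤ _ := by
        refine sum_le_sum fun r hr => ?_
        rw [← sum_filter]
        refine sum_le_sum_of_subset_of_nonneg (fun e he => ?_) fun e _ _ => ?_
        · simp only [mem_filter, mem_freeAt, youngAt] at he ⊢
          exact ⟨⟨he.1.1, he.2.1⟩, he.2.2⟩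
        · exact edgeWeight_nonneg (h.ext_succ r (by simp only [mem_range] at hr; omega)) e

/-- At a young edge at least `k - D / 2 - D ≥ k / 8` colours are available and outside `A`. Another
factor `1 / 2` is lost since an edge may have both of its endpoints in `W`. -/
theorem le_hitWeight_youngAvoiding {d c : PartialColouring G k} (h : Extends d c) (hk : 0 < k)
    (hkD : 12 * D ≤ 7 * k) (W : Finset V) {A : Finset (Fin k)} (hA : #A ≤ D) :
    (∑ w ∈ W, ∑ e ∈ youngAt D c w, edgeWeight b d c e) / 16 ≤
      hitWeight b d c (YoungAvoiding D W A c) := by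
  set T : Finset G.edgeSet := univ.filter fun e =>
    c e = none ∧ Young D c e ∧ ∃ w ∈ W, w ∈ (e : Sym2 V) with hT
  set I : G.edgeSet → Finset (Fin k) := fun e => univ.filter fun i => Available c e i ∧ i ∈ Aᶜ
    with hI
  have hcard : ∀ e ∈ T, (1 / 8 : ℝ) * k ≤ #(I e) := by
    intro e he
    simp only [hT, mem_filter, mem_univ, true_and] at he
    have hsub : (I e)ᶜ ⊆ A ∪ (univ.filter fun v => v ∈ (e : Sym2 V)).biUnion (coloursAt c) := by
      intro i hi
      by_contra hcon
      simp only [mem_union, mem_biUnion, mem_filter, mem_univ, true_and, not_or, not_exists,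
        not_and, mem_coloursAt] at hcon
      refine mem_compl.1 hi ?_
      simp only [hI, mem_filter, mem_univ, true_and]
      refine ⟨fun f hf hfi => ?_, by simpa using hcon.1⟩
      obtain ⟨-, v, hv, hv'⟩ := hf
      exact hcon.2 v hv f hv' hfi
    have h1 := (card_le_card hsub).trans (card_union_le _ _)
    have h2 : #((univ.filter fun v => v ∈ (e : Sym2 V)).biUnion (coloursAt c)) ≤ 2 * (D / 4) := by
      refine (card_biUnion_le_card_mul _ _ (D / 4) fun v hv => ?_).trans (by rw [card_endpoints])
      have := he.2.1 v (by simpa using hv)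
      have := card_coloursAt_le_load c v
      omega
    rw [card_compl, Fintype.card_fin] at h1
    have : k ≤ 8 * #(I e) := by omega
    have : (k : ℝ) ≤ 8 * #(I e) := by exact_mod_cast this
    linarith
  have h1 := le_hitWeight (b := b) h hk (S := YoungAvoiding D W A c) T I
    (fun e he => by simp only [hT, mem_filter, mem_univ, true_and] at he; exact he.1)
    (fun e he i hi => by
      simp only [hT, hI, mem_filter, mem_univ, true_and] at he hi
      exact ⟨hi.1, hi.2, he.2.1, he.2.2⟩) hcard
  have h2 : ∑ w ∈ W, ∑ e ∈ youngAt D c w, edgeWeight b d c e ≤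
      2 * ∑ e ∈ T, edgeWeight b d c e := by
    have : ∀ w ∈ W, youngAt D c w = T.filter fun e : G.edgeSet => w ∈ (e : Sym2 V) := by
      intro w hw
      ext e
      simp only [hT, youngAt, mem_filter, mem_freeAt, mem_univ, true_and]
      constructor
      · rintro ⟨⟨h1, h2⟩, h3⟩
        exact ⟨⟨h2, h3, w, hw, h1⟩, h1⟩
      · rintro ⟨⟨h2, h3, -⟩, h1⟩
        exact ⟨⟨h1, h2⟩, h3⟩
    rw [sum_congr rfl fun w hw => by rw [this w hw, sum_filter], sum_comm, mul_sum]
    refine sum_le_sum fun e _ => ?_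
    rw [← sum_filter, sum_const, nsmul_eq_mul]
    refine mul_le_mul_of_nonneg_right ?_ (edgeWeight_nonneg h e)
    have : #(W.filter fun w => w ∈ (e : Sym2 V)) ≤ 2 := by
      rw [← card_endpoints e]
      exact card_le_card fun v hv => by simpa using (mem_filter.1 hv).2
    exact_mod_cast this
  linarith

theorem Run.le_drift_youngAvoiding (h : Run b R c m) (hD : ∀ v, #(edgesAt G v) ≤ D)
    (hbD : 8 * (b + 1) ≤ D) (hkD : 12 * D ≤ 7 * k) {W : Finset V} {A : Finset (Fin k)}
    (hA : #A ≤ D) (hW : ∀ w ∈ W, 3 * D ≤ 4 * #(edgesAt G w) ∧ D ≤ 4 * load (c (R + 1)) w) :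
    #W * D / (512 * ((b : ℝ) + 1)) ≤ drift b (YoungAvoiding D W A) c R := by
  calc #W * D / (512 * ((b : ℝ) + 1)) = (∑ w ∈ W, D / (32 * ((b : ℝ) + 1))) / 16 := by
        rw [sum_const, nsmul_eq_mul]; field_simp; ring
    _ ≤ (∑ w ∈ W, ∑ r ∈ range R, ∑ e ∈ youngAt D (c (r + 1)) w,
          edgeWeight b (c r) (c (r + 1)) e) / 16 := by
        gcongr with w hw
        exact h.le_sum_youngAt hD hbD (hW w hw).1 (hW w hw).2
    _ = ∑ r ∈ range R, (∑ w ∈ W, ∑ e ∈ youngAt D (c (r + 1)) w,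
          edgeWeight b (c r) (c (r + 1)) e) / 16 := by rw [sum_comm, sum_div]
    _ ≤ _ := sum_le_sum fun r hr =>
        le_hitWeight_youngAvoiding (h.ext_succ r (by simp only [mem_range] at hr; omega))
          (by omega) hkD W hA

end Young

/-! ### Common colours at the endpoints of an edge -/

section Gain

variable {V : Type*} [Fintype V] {G : SimpleGraph V} {k : ℕ}
variable {b R D ω : ℕ} {c : ℕ → PartialColouring G k} {m : ℕ → G.edgeSet × Fin k}

/-- Only few old vertices of large degree have almost all of their colours in `A`. With `ω` such
vertices, the drift would be at least `16 * D`, and the hits at most `4 * D`. -/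
theorem Run.card_exceptional_lt (h : Run b R c m) (hb : 1 ≤ b) (hD : ∀ v, #(edgesAt G v) ≤ D)
    (hbD : 8 * (b + 1) ≤ D) (hkD : 12 * D ≤ 7 * k) (hω : ω = 2 ^ 14 * b) {L : ℝ}
    (hL : L ≤ 3 * D) {A : Finset (Fin k)} (hA : #A ≤ D)
    (hbal : ∀ W : Finset V, #W = ω →
      drift b (YoungAvoiding D W A) c R / 2 - L ≤ hits (YoungAvoiding D W A) c m R) :
    #{w | 3 * D ≤ 4 * #(edgesAt G w) ∧ D ≤ 4 * load (c (R + 1)) w ∧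
      ω * #(coloursAt (c (R + 1)) w \ A) ≤ 4 * D} < ω := by
  by_contra! hcon
  obtain ⟨W, hWs, hW⟩ := exists_subset_card_eq hcon
  have hW' : ∀ w ∈ W, 3 * D ≤ 4 * #(edgesAt G w) ∧ D ≤ 4 * load (c (R + 1)) w ∧
      ω * #(coloursAt (c (R + 1)) w \ A) ≤ 4 * D := fun w hw => by simpa using hWs hw
  have h1 := h.le_drift_youngAvoiding hD hbD hkD hA (W := W)
    fun w hw => ⟨(hW' w hw).1, (hW' w hw).2.1⟩
  have h2 := h.hits_le (YoungAvoiding D W A) W Aᶜ fun r _ hr => ⟨hr.1, hr.2.2⟩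
  have h3 : hits (YoungAvoiding D W A) c m R ≤ 4 * D := by
    have hω0 : 0 < ω := by omega
    refine Nat.le_of_mul_le_mul_left ?_ hω0
    calc ω * hits (YoungAvoiding D W A) c m R
        ≤ ω * ∑ w ∈ W, #(coloursAt (c (R + 1)) w ∩ Aᶜ) := Nat.mul_le_mul_left _ h2
      _ = ∑ w ∈ W, ω * #(coloursAt (c (R + 1)) w \ A) := by
          rw [mul_sum]; simp only [sdiff_eq_inter_compl]
      _ ≤ ∑ w ∈ W, 4 * D := sum_le_sum fun w hw => (hW' w hw).2.2
      _ = ω * (4 * D) := by rw [sum_const, hW, smul_eq_mul]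
  have h4 := hbal W hW
  have h5 : (16 : ℝ) * D ≤ #W * D / (512 * ((b : ℝ) + 1)) := by
    have hb' : (1 : ℝ) ≤ b := by exact_mod_cast hb
    rw [hW, hω, le_div_iff₀ (by positivity)]
    push_cast
    nlinarith [(Nat.cast_nonneg D : (0 : ℝ) ≤ D)]
  have h6 : (hits (YoungAvoiding D W A) c m R : ℝ) ≤ 4 * D := by exact_mod_cast h3
  have h7 : (0 : ℝ) < D := by
    have : 0 < D := by omega
    exact_mod_cast this
  linarith

/-- The move colours an edge at `v`, other than `uv`, with a colour that occurs at `u`. By the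
legality of the move this gives a new common colour of `u` and `v`. -/
def Gain (u v : V) (c : PartialColouring G k) (m : G.edgeSet × Fin k) : Prop :=
  m.2 ∈ coloursAt c u ∧ v ∈ (m.1 : Sym2 V) ∧ u ∉ (m.1 : Sym2 V)

theorem hitWeight_nonneg {d c : PartialColouring G k} (h : Extends d c)
    (S : G.edgeSet × Fin k → Prop) : 0 ≤ hitWeight b d c S :=
  sum_nonneg fun m _ => by
    split_ifs
    · exact moveWeight_nonneg h m
    · exact le_rfl

/-- If `u` is almost saturated and shares few colours with `v`, then an answer at `v` gives a common
colour of `u` and `v` with probability at least `1 / (2 * ω)`. The hypothesis `hexc` is what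
`Run.card_exceptional_lt` provides. -/
theorem le_hitWeight_gain {d c : PartialColouring G k} (h : Extends d c) (hc : Proper c)
    (hD : ∀ v, #(edgesAt G v) ≤ D) (hk : 0 < k) (hkD : k ≤ 2 * D)
    (hω : 2 ^ 14 ≤ ω) (hωD : 8 * ω ^ 2 ≤ D) {u v : V} (huv : u ≠ v)
    (hu : (D : ℝ) - D / ω ≤ load c u) (hv : (load c v : ℝ) ≤ D - D / (2 * ω))
    (hdeg : (D : ℝ) - D / (4 * ω) ≤ #(edgesAt G v))
    (hint : (#(coloursAt c u ∩ coloursAt c v) : ℝ) ≤ D / (8 * ω))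
    (hexc : #{w | 3 * D ≤ 4 * #(edgesAt G w) ∧ D ≤ 4 * load c w ∧
      ω * #(coloursAt c w \ (coloursAt c u \ coloursAt c v)) ≤ 4 * D} < ω) :
    ((load c v : ℝ) - load d v) / (4 * ω * ((b : ℝ) + 1)) ≤ hitWeight b d c (Gain u v c) := by
  have hcancel : ∀ X w y n : ℝ, 0 < w → 0 < y → 0 < n →
      X / (4 * w * y) = 1 / w * (n / 2 * (X / (2 * y * n))) := by
    intro X w y n hw hy hn
    field_simp
    norm_num
  set A := coloursAt c u \ coloursAt c v with hA
  set B : Finset V := univ.filter fun w => 3 * D ≤ 4 * #(edgesAt G w) ∧ D ≤ 4 * load c w ∧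
      ω * #(coloursAt c w \ A) ≤ 4 * D with hB
  set T : Finset G.edgeSet := (freeAt c v).filter fun e : G.edgeSet =>
    ¬ ∃ w ∈ insert u B, w ≠ v ∧ w ∈ (e : Sym2 V) with hT
  set I : G.edgeSet → Finset (Fin k) := fun e => A.filter fun i => Available c e i with hI
  have hωr : (2 : ℝ) ^ 14 ≤ ω := by exact_mod_cast hω
  have hω0 : (0 : ℝ) < ω := lt_of_lt_of_le (by norm_num) hωr
  have hωDr : 8 * (ω : ℝ) ^ 2 ≤ D := by exact_mod_cast hωD
  obtain ⟨x, hx⟩ : ∃ x : ℝ, x = (D : ℝ) / ω := ⟨_, rfl⟩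
  have hxD : (D : ℝ) = ω * x := by rw [hx]; field_simp
  have hx2 : (D : ℝ) / (2 * ω) = x / 2 := by rw [hx]; field_simp
  have hx4 : (D : ℝ) / (4 * ω) = x / 4 := by rw [hx]; field_simp
  have hx8 : (D : ℝ) / (8 * ω) = x / 8 := by rw [hx]; field_simp
  have hxω : 8 * (ω : ℝ) ≤ x := by rw [hx, le_div_iff₀ hω0]; linarith
  have hx0 : 0 ≤ x := by linarith
  have hxle : 2 ^ 14 * x ≤ D := by rw [hxD]; gcongr
  rw [← hx] at hu
  rw [hx2] at hv
  rw [hx4] at hdeg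
  rw [hx8] at hint
  have hcardA : (D : ℝ) - 9 / 8 * x ≤ #A := by
    have h1 : #(coloursAt c u) ≤ #A + #(coloursAt c u ∩ coloursAt c v) := by
      rw [hA, card_sdiff_add_card_inter]
    have h1' : (#(coloursAt c u) : ℝ) ≤ #A + #(coloursAt c u ∩ coloursAt c v) := by
      exact_mod_cast h1
    have h2 : (load c u : ℝ) ≤ #(coloursAt c u) := by
      exact_mod_cast hc.load_le_card_coloursAt u
    linarith
  have hcard : ∀ e ∈ T, (1 / ω : ℝ) * k ≤ #(I e) := by
    intro e he
    simp only [hT, mem_filter, mem_freeAt] at he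
    obtain ⟨⟨hve, hce⟩, hex⟩ := he
    obtain ⟨w, hw⟩ := hve
    have hvw : w ≠ v := by
      rintro rfl
      have := e.2
      rw [hw] at this
      exact G.loopless.irrefl _ this
    have hwB : w ∉ B := fun hwB => hex ⟨w, mem_insert_of_mem hwB, hvw, by rw [hw]; simp⟩
    have hsub : A \ coloursAt c w ⊆ I e := by
      intro i hi
      simp only [mem_sdiff] at hi
      simp only [hI, mem_filter]
      refine ⟨hi.1, fun f hf hfi => ?_⟩
      obtain ⟨-, y, hy, hy'⟩ := hf
      rw [hw, Sym2.mem_iff] at hy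
      rcases hy with rfl | rfl
      · exact (mem_sdiff.1 hi.1).2 (mem_coloursAt.2 ⟨f, hy', hfi⟩)
      · exact hi.2 (mem_coloursAt.2 ⟨f, hy', hfi⟩)
    have h1 : (#(A \ coloursAt c w) : ℝ) ≤ #(I e) := by exact_mod_cast card_le_card hsub
    have h2 : (#A : ℝ) = #(A \ coloursAt c w) + #(A ∩ coloursAt c w) := by
      exact_mod_cast (card_sdiff_add_card_inter A (coloursAt c w)).symm
    have h3 : (#(A ∩ coloursAt c w) : ℝ) ≤ #(coloursAt c w) := by
      exact_mod_cast card_le_card inter_subset_right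
    have h4 : (#(coloursAt c w) : ℝ) ≤ load c w := by exact_mod_cast card_coloursAt_le_load c w
    have h5 : (load c w : ℝ) ≤ #(edgesAt G w) := by exact_mod_cast card_filter_le _ _
    have h6 : (#(edgesAt G w) : ℝ) ≤ D := by exact_mod_cast hD w
    -- `w` has small degree, or is young, or has many colours outside `A`
    have h7 : 2 * x ≤ #(A \ coloursAt c w) := by
      simp only [hB, mem_filter, mem_univ, true_and, not_and_or, not_le] at hwB
      rcases hwB with h' | h' | h'
      · have : (4 * #(edgesAt G w) : ℝ) < 3 * D := by exact_mod_cast h'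
        linarith
      · have : (4 * load c w : ℝ) < D := by exact_mod_cast h'
        linarith
      · have h8 : (4 * D : ℝ) < ω * #(coloursAt c w \ A) := by exact_mod_cast h'
        have h9 : 4 * x < #(coloursAt c w \ A) := by
          rw [hxD] at h8
          nlinarith
        have h10 : (#(coloursAt c w) : ℝ) = #(coloursAt c w \ A) + #(A ∩ coloursAt c w) := by
          rw [inter_comm]
          exact_mod_cast (card_sdiff_add_card_inter (coloursAt c w) A).symm
        linarith
    have h8 : (k : ℝ) ≤ 2 * D := by exact_mod_cast hkD
    calc (1 / ω : ℝ) * k ≤ 1 / ω * (2 * D) := by gcongr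
      _ = 2 * x := by rw [hx]; ring
      _ ≤ _ := h7.trans h1
  have h1 := le_hitWeight (b := b) h hk (S := Gain u v c) T I
    (fun e he => (mem_freeAt.1 (mem_filter.1 he).1).2)
    (fun e he i hi => by
      simp only [hI, mem_filter, hA, mem_sdiff] at hi
      simp only [hT, mem_filter, mem_freeAt] at he
      exact ⟨hi.2, hi.1.1, he.1.1, fun hue => he.2 ⟨u, mem_insert_self _ _, huv, hue⟩⟩) hcard
  have hTcard : (#(freeAt c v) : ℝ) ≤ 2 * #T := by
    have h2 := card_filter_exists_endpoint_le (freeAt c v) v (filter_subset _ _) (insert u B)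
    have h3 : #(insert u B) ≤ ω := (card_insert_le _ _).trans hexc
    have h4 : #((freeAt c v).filter fun e : G.edgeSet =>
        ∃ w ∈ insert u B, w ≠ v ∧ w ∈ (e : Sym2 V)) + #T = #(freeAt c v) :=
      card_filter_add_card_filter_not _
    have h5 : #(freeAt c v) ≤ ω + #T := by omega
    have h5' : (#(freeAt c v) : ℝ) ≤ ω + #T := by exact_mod_cast h5
    have h6 : (#(freeAt c v) + load c v : ℝ) = #(edgesAt G v) := by
      exact_mod_cast card_freeAt_add_load c v
    linarith
  have hfree : (0 : ℝ) < #(freeAt c v) := by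
    have h6 : (#(freeAt c v) + load c v : ℝ) = #(edgesAt G v) := by
      exact_mod_cast card_freeAt_add_load c v
    linarith
  refine le_trans ?_ h1
  have h2 : #T * rate b d c v ≤ ∑ e ∈ T, edgeWeight b d c e := by
    rw [← nsmul_eq_mul]
    refine card_nsmul_le_sum _ _ _ fun e he => rate_le_edgeWeight h ?_
    exact (mem_freeAt.1 (mem_filter.1 he).1).1
  have h3 : #(freeAt c v) / 2 * rate b d c v ≤ #T * rate b d c v :=
    mul_le_mul_of_nonneg_right (by linarith) (rate_nonneg h v)
  calc ((load c v : ℝ) - load d v) / (4 * ω * ((b : ℝ) + 1))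
      = 1 / ω * (#(freeAt c v) / 2 * rate b d c v) :=
        hcancel _ _ _ _ hω0 (by positivity) hfree
    _ ≤ 1 / ω * ∑ e ∈ T, edgeWeight b d c e := by gcongr; linarith

/-- If `v` has load more than `(1 - 1 / K) * D` at the end, and `u` reaches load `(1 - 1 / ω) * D`
no later than `v` does, then `u` and `v` have at least `D / K` common colours at the end. -/
theorem Run.le_card_inter (h : Run b R c m) (hb : 1 ≤ b) (hD : ∀ v, #(edgesAt G v) ≤ D)
    (hkD : k ≤ 2 * D) (hkD' : 12 * D ≤ 7 * k) (hω : ω = 2 ^ 14 * b) {K : ℕ}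
    (hK : K = 2 ^ 7 * ω ^ 2 * b) (hKD : 2 * K ≤ D) {L₁ L₂ : ℝ}
    (hL₁ : L₁ ≤ 3 * D) (hL₂ : L₂ ≤ D / K)
    (hbal₁ : ∀ r ≤ R, ∀ (W : Finset V) (A : Finset (Fin k)), #W = ω →
      drift b (YoungAvoiding D W A) c r / 2 - L₁ ≤ hits (YoungAvoiding D W A) c m r)
    {u v : V} (hbal₂ : drift b (Gain u v) c R / 2 - L₂ ≤ hits (Gain u v) c m R)
    (huv : u ≠ v) (hv : (D : ℝ) - D / K < load (c (R + 1)) v) {T₁ : ℕ} (hT₁R : T₁ ≤ R)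
    (hT₁u : (D : ℝ) - D / ω ≤ load (c (T₁ + 1)) u)
    (hT₁v : (load (c T₁) v : ℝ) < D - D / ω) :
    D ≤ K * #(coloursAt (c (R + 1)) u ∩ coloursAt (c (R + 1)) v) := by
  by_contra! hint
  have hω1 : 2 ^ 14 ≤ ω := by omega
  have hω2 : ω ≤ ω ^ 2 := Nat.le_self_pow (by norm_num) _
  have hKω : 2 ^ 7 * ω ^ 2 ≤ K := by rw [hK]; exact Nat.le_mul_of_pos_right _ hb
  have hbω : b ≤ ω := by omega
  have hωω : b * ω ≤ ω ^ 2 := by rw [sq]; exact Nat.mul_le_mul_right _ hbω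
  have hbD : 8 * (b + 1) ≤ D := by omega
  have hk : 0 < k := by omega
  have hKr : (0 : ℝ) < K := by
    have : 0 < K := by omega
    exact_mod_cast this
  have hDr : (0 : ℝ) < D := by
    have : 0 < D := by omega
    exact_mod_cast this
  have hω0 : (0 : ℝ) < ω := by
    have : 0 < ω := by omega
    exact_mod_cast this
  have hbr : (1 : ℝ) ≤ b := by exact_mod_cast hb
  have hK16 : (16 * ω : ℝ) ≤ K := by
    have : 16 * ω ≤ K := by omega
    exact_mod_cast this
  have hKω8 : (D : ℝ) / K ≤ D / (8 * ω) :=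
    div_le_div_of_nonneg_left hDr.le (by positivity) (by linarith)
  have hKω4 : (D : ℝ) / K ≤ D / (2 * ω) := by
    apply div_le_div_of_nonneg_left hDr.le (by positivity)
    linarith
  have hhalf : (D : ℝ) / ω = D / (2 * ω) + D / (2 * ω) := by field_simp; norm_num
  have hquarter : (D : ℝ) / (2 * ω) = D / (4 * ω) + D / (4 * ω) := by field_simp; norm_num
  have heighth : (D : ℝ) / (4 * ω) = D / (8 * ω) + D / (8 * ω) := by field_simp; norm_num
  have hpos : (0 : ℝ) < D / (8 * ω) := by positivity
  obtain ⟨T₂, hT₂R, hT₂, hT₂'⟩ := exists_lt_le_succ (f := fun s => load (c s) v)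
    (θ := D - D / (2 * ω)) (r := R + 1)
    (by
      rw [h.load_zero, Nat.cast_zero, sub_pos]
      apply div_lt_self hDr
      have : (1 : ℝ) ≤ ω := by exact_mod_cast (show 1 ≤ ω by omega)
      linarith)
    (by linarith)
  have hT₂R : T₂ ≤ R := by omega
  have hT₁₂ : T₁ ≤ T₂ := by
    by_contra hlt
    have h1 : (load (c (T₂ + 1)) v : ℝ) ≤ load (c T₁) v := by
      exact_mod_cast h.load_mono (show T₂ + 1 ≤ T₁ by omega) (by omega) v
    linarith
  have hdeg : (D : ℝ) - D / (4 * ω) ≤ #(edgesAt G v) := by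
    have h1 : (load (c (R + 1)) v : ℝ) ≤ #(edgesAt G v) := by
      exact_mod_cast card_filter_le _ _
    linarith
  have hdrift : (D : ℝ) / (4 * ω) / (4 * ω * (b + 1)) ≤ drift b (Gain u v) c R := by
    calc (D : ℝ) / (4 * ω) / (4 * ω * (b + 1))
        ≤ (load (c T₂) v - load (c T₁) v) / (4 * ω * (b + 1)) := by
          have h1 : (load (c (T₂ + 1)) v : ℝ) ≤ load (c T₂) v + (b + 1) := by
            exact_mod_cast h.load_succ_le hT₂R v
          have h2 : (b + 1 : ℝ) ≤ D / (4 * ω) := by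
            rw [le_div_iff₀ (by positivity)]
            have : (b + 1) * (4 * ω) ≤ D := by linarith
            exact_mod_cast this
          gcongr
          linarith
      _ = ∑ t ∈ Ico T₁ T₂, ((load (c (t + 1)) v : ℝ) - load (c t) v) /
            (4 * ω * (b + 1)) := by
          rw [← sum_div, sum_Ico_sub (fun t => (load (c t) v : ℝ)) hT₁₂]
      _ ≤ ∑ t ∈ Ico T₁ T₂, hitWeight b (c t) (c (t + 1)) (Gain u v (c (t + 1))) := by
          refine sum_le_sum fun t ht => ?_
          have ht := mem_Ico.1 ht
          have hrun := h.truncate (show t ≤ R by omega)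
          have hA : #(coloursAt (c (t + 1)) u \ coloursAt (c (t + 1)) v) ≤ D :=
            (card_le_card sdiff_subset).trans ((card_coloursAt_le_load _ _).trans
              ((card_filter_le _ _).trans (hD u)))
          refine le_hitWeight_gain (h.ext_succ t (by omega)) hrun.proper hD hk hkD hω1
            (by omega) huv ?_ ?_ hdeg ?_ ?_
          · refine hT₁u.trans ?_
            exact_mod_cast h.load_mono (show T₁ + 1 ≤ t + 1 by omega) (by omega) u
          · refine le_trans ?_ hT₂.le
            exact_mod_cast h.load_mono (show t + 1 ≤ T₂ by omega) (by omega) v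
          · refine le_trans ?_ hKω8
            rw [le_div_iff₀ hKr]
            have hext := h.ext (show t + 1 ≤ R + 1 by omega) le_rfl
            have h1 := card_le_card (inter_subset_inter (coloursAt_mono hext u)
              (coloursAt_mono hext v))
            have h2 : #(coloursAt (c (t + 1)) u ∩ coloursAt (c (t + 1)) v) * K ≤ D := by
              rw [mul_comm] at hint
              exact (Nat.mul_le_mul_right K h1).trans hint.le
            exact_mod_cast h2
          · exact hrun.card_exceptional_lt hb hD hbD hkD' hω hL₁ hA
              fun W hW => hbal₁ t (by omega) W _ hW
      _ ≤ drift b (Gain u v) c R := by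
          refine sum_le_sum_of_subset_of_nonneg (fun t ht => ?_) fun t ht _ => ?_
          · simp only [mem_Ico, mem_range] at ht ⊢; omega
          · exact hitWeight_nonneg (h.ext_succ t (by simp only [mem_range] at ht; omega)) _
  have hhits := h.hits_le (Gain u v) {v} (coloursAt (c (R + 1)) u) fun r hr hS =>
    ⟨coloursAt_mono (h.ext (show r + 1 ≤ R + 1 by omega) le_rfl) u hS.1, v,
      mem_singleton_self v, hS.2.1⟩
  rw [sum_singleton, inter_comm] at hhits
  have h1 : (hits (Gain u v) c m R : ℝ) < D / K := by
    rw [lt_div_iff₀ hKr]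
    have : hits (Gain u v) c m R * K < D := by
      rw [mul_comm]
      exact (Nat.mul_le_mul_left K hhits).trans_lt hint
    exact_mod_cast this
  have h3 : (4 : ℝ) * (D / K) ≤ D / (4 * ω) / (4 * ω * (b + 1)) := by
    rw [hK, div_div, mul_div_assoc', div_le_div_iff₀ (by positivity) (by positivity)]
    push_cast
    have : (4 : ℝ) * D * (4 * ω * (4 * ω * (b + 1))) = D * (64 * ω ^ 2 * (b + 1)) := by ring
    rw [this]
    have h5 : (64 : ℝ) * ω ^ 2 * (b + 1) ≤ 128 * ω ^ 2 * b := by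
      nlinarith [mul_le_mul_of_nonneg_left hbr (sq_nonneg (ω : ℝ))]
    exact mul_le_mul_of_nonneg_left h5 hDr.le
  linarith

/-- If the hits of all the events are as many as the drift predicts, then no uncoloured edge is
blocked. -/
theorem Run.exists_available (h : Run b R c m) (hb : 1 ≤ b) (hD : ∀ v, #(edgesAt G v) ≤ D)
    (hω : ω = 2 ^ 14 * b) {K : ℕ} (hK : K = 2 ^ 7 * ω ^ 2 * b) (hKD : 2 * K ≤ D)
    (hkD : k ≤ 2 * D) (hDk : K * (2 * D) < K * (k + 1) + D) {L₁ L₂ : ℝ}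
    (hL₁ : L₁ ≤ 3 * D) (hL₂ : L₂ ≤ D / K)
    (hbal₁ : ∀ r ≤ R, ∀ (W : Finset V) (A : Finset (Fin k)), #W = ω →
      drift b (YoungAvoiding D W A) c r / 2 - L₁ ≤ hits (YoungAvoiding D W A) c m r)
    (hbal₂ : ∀ u v : V, drift b (Gain u v) c R / 2 - L₂ ≤ hits (Gain u v) c m R)
    {e : G.edgeSet} (he : c (R + 1) e = none) : ∃ i, Available (c (R + 1)) e i := by
  by_contra hcon
  have hω1 : 2 ^ 14 ≤ ω := by omega
  have hω2 : ω ≤ ω ^ 2 := Nat.le_self_pow (by norm_num) _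
  have hKω : 2 ^ 7 * ω ^ 2 ≤ K := by rw [hK]; exact Nat.le_mul_of_pos_right _ hb
  have hkD' : 12 * D ≤ 7 * k := by
    have h1 : 2 ^ 7 ≤ K := by omega
    by_contra! hlt
    have h2 : 2 * D - (k + 1) ≥ 1 := by omega
    have h3 : K * (2 * D) = K * (2 * D - (k + 1)) + K * (k + 1) := by
      rw [← mul_add]; congr 1; omega
    have h4 : K * (2 * D - (k + 1)) < D := by omega
    have h5 : 2 ^ 7 * (2 * D - (k + 1)) < D := lt_of_le_of_lt (Nat.mul_le_mul_right _ h1) h4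
    omega
  have hKr : (0 : ℝ) < K := by
    have : 0 < K := by omega
    exact_mod_cast this
  have hDr : (0 : ℝ) < D := by
    have : 0 < D := by omega
    exact_mod_cast this
  have hω0 : (0 : ℝ) < ω := by
    have : 0 < ω := by omega
    exact_mod_cast this
  have key : ∀ u v : V, u ≠ v → (D : ℝ) - D / K < load (c (R + 1)) v →
      K * #(coloursAt (c (R + 1)) u ∩ coloursAt (c (R + 1)) v) < D →
      ∀ T₁ ≤ R, (D : ℝ) - D / ω ≤ load (c (T₁ + 1)) u →
        (load (c T₁) v : ℝ) < D - D / ω → False := fun u v huv hv hint T₁ hT₁R hT₁u hT₁v =>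
    (h.le_card_inter hb hD hkD hkD' hω hK (by omega) hL₁ hL₂ hbal₁ (hbal₂ u v) huv hv hT₁R
      hT₁u hT₁v).not_gt hint
  obtain ⟨u, v, huv⟩ : ∃ u v, (e : Sym2 V) = s(u, v) := by
    induction h : (e : Sym2 V) using Sym2.ind with
    | _ x y => exact ⟨x, y, rfl⟩
  have hne : u ≠ v := by
    rintro rfl
    have := e.2
    rw [huv] at this
    exact G.loopless.irrefl _ this
  have hcover : (univ : Finset (Fin k)) ⊆ coloursAt (c (R + 1)) u ∪ coloursAt (c (R + 1)) v := by
    intro i _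
    have : ¬ Available (c (R + 1)) e i := fun hi => hcon ⟨i, hi⟩
    simp only [Available, not_forall, not_not] at this
    obtain ⟨f, ⟨-, x, hx, hx'⟩, hf⟩ := this
    rw [huv, Sym2.mem_iff] at hx
    rw [mem_union, mem_coloursAt, mem_coloursAt]
    rcases hx with rfl | rfl
    · exact Or.inl ⟨f, hx', hf⟩
    · exact Or.inr ⟨f, hx', hf⟩
  have hkle := card_le_card hcover
  have hui := card_union_add_card_inter (coloursAt (c (R + 1)) u) (coloursAt (c (R + 1)) v)
  rw [card_univ, Fintype.card_fin] at hkle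
  have hlt : ∀ x ∈ (e : Sym2 V), load (c (R + 1)) x + 1 ≤ D := by
    intro x hx
    have h1 : 0 < #(freeAt (c (R + 1)) x) := card_pos.2 ⟨e, mem_freeAt.2 ⟨hx, he⟩⟩
    have h2 := card_freeAt_add_load (c (R + 1)) x
    have h3 := hD x
    omega
  have hu1 := hlt u (by simp [huv])
  have hv1 := hlt v (by simp [huv])
  have hu2 := card_coloursAt_le_load (c (R + 1)) u
  have hv2 := card_coloursAt_le_load (c (R + 1)) v
  have hint : K * #(coloursAt (c (R + 1)) u ∩ coloursAt (c (R + 1)) v) < D := by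
    have : #(coloursAt (c (R + 1)) u ∩ coloursAt (c (R + 1)) v) + (k + 1) ≤ 2 * D := by omega
    nlinarith
  have hload : ∀ x ∈ (e : Sym2 V), (D : ℝ) - D / K < load (c (R + 1)) x := by
    intro x hx
    have h1 : D + k + 1 ≤ 2 * D + load (c (R + 1)) x := by
      rw [huv, Sym2.mem_iff] at hx
      rcases hx with rfl | rfl <;> omega
    have h2 : K * D < K * load (c (R + 1)) x + D := by nlinarith
    have h2' : (K * D : ℝ) < K * load (c (R + 1)) x + D := by exact_mod_cast h2
    rw [sub_lt_iff_lt_add, ← sub_lt_iff_lt_add', lt_div_iff₀ hKr]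
    linarith
  have hKω1 : (D : ℝ) / K ≤ D / ω := by
    apply div_le_div_of_nonneg_left hDr.le (by positivity)
    exact_mod_cast (show ω ≤ K by omega)
  have hcross : ∀ x ∈ (e : Sym2 V), ∃ T ≤ R, (load (c T) x : ℝ) < D - D / ω ∧
      (D : ℝ) - D / ω ≤ load (c (T + 1)) x := by
    intro x hx
    obtain ⟨T, hT, hT'⟩ := exists_lt_le_succ (f := fun s => load (c s) x)
      (θ := D - D / ω) (r := R + 1)
      (by
        rw [h.load_zero, Nat.cast_zero, sub_pos]
        apply div_lt_self hDr
        exact_mod_cast (show 1 < ω by omega))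
      (by linarith [hload x hx])
    exact ⟨T, by omega, hT'⟩
  obtain ⟨Tu, hTu, hTu1, hTu2⟩ := hcross u (by simp [huv])
  obtain ⟨Tv, hTv, hTv1, hTv2⟩ := hcross v (by simp [huv])
  rcases le_total Tu Tv with hle | hle
  · refine key u v hne (hload v (by simp [huv])) hint Tv hTv (hTu2.trans ?_) hTv1
    exact_mod_cast h.load_mono (show Tu + 1 ≤ Tv + 1 by omega) (by omega) u
  · refine key v u hne.symm (hload u (by simp [huv])) (by rwa [inter_comm]) Tu hTu
      (hTv2.trans ?_) hTu1
    exact_mod_cast h.load_mono (show Tv + 1 ≤ Tu + 1 by omega) (by omega) v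

end Gain

/-! ### The derandomised strategy -/

section Strategy

variable {V : Type*} [Fintype V] {G : SimpleGraph V} {k : ℕ} {ι : Type*} [Fintype ι]

/-- The weighted sum of the supermartingales of the events `S j`, with initial weights
`exp (-ℓ j)`, after Maker's first `R` moves. -/
noncomputable def potential (b : ℕ) (S : ι → PartialColouring G k → G.edgeSet × Fin k → Prop)
    (ℓ : ι → ℝ) (c : ℕ → PartialColouring G k) (m : ℕ → G.edgeSet × Fin k) (R : ℕ) : ℝ :=
  ∑ j, Real.exp (-ℓ j) * Real.exp (drift b (S j) c R / 2 - hits (S j) c m R)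

variable {b R : ℕ} {S : ι → PartialColouring G k → G.edgeSet × Fin k → Prop} {ℓ : ι → ℝ}
  {c c' : ℕ → PartialColouring G k} {m m' : ℕ → G.edgeSet × Fin k}

theorem drift_div_two_sub_le_hits (h : potential b S ℓ c m R ≤ 1) (j : ι) :
    drift b (S j) c R / 2 - ℓ j ≤ hits (S j) c m R := by
  have h1 : Real.exp (-ℓ j) * Real.exp (drift b (S j) c R / 2 - hits (S j) c m R) ≤ 1 :=
    (single_le_sum (f := fun j => Real.exp (-ℓ j) *
      Real.exp (drift b (S j) c R / 2 - hits (S j) c m R))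
      (fun i _ => by positivity) (mem_univ j)).trans h
  rw [← Real.exp_add, Real.exp_le_one_iff] at h1
  linarith

theorem potential_congr (hc : ∀ r ≤ R, c r = c' r) (hm : ∀ r < R, m r = m' r) :
    potential b S ℓ c m R = potential b S ℓ c' m' R := by
  refine sum_congr rfl fun j _ => ?_
  have h1 : drift b (S j) c R = drift b (S j) c' R := sum_congr rfl fun r hr => by
    have hr := mem_range.1 hr
    rw [hc r (by omega), hc (r + 1) (by omega)]
  have h2 : hits (S j) c m R = hits (S j) c' m' R := by
    unfold hits
    congr 1
    refine filter_congr fun r hr => ?_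
    have hr := mem_range.1 hr
    rw [hc (r + 1) (by omega), hm r hr]
  rw [h1, h2]

theorem potential_succ : potential b S ℓ c m (R + 1) =
    ∑ j, Real.exp (-ℓ j) * Real.exp (drift b (S j) c R / 2 - hits (S j) c m R) *
      Real.exp (hitWeight b (c R) (c (R + 1)) (S j (c (R + 1))) / 2 -
        if S j (c (R + 1)) (m R) then 1 else 0) := by
  refine sum_congr rfl fun j _ => ?_
  have h1 : drift b (S j) c (R + 1) = drift b (S j) c R +
      hitWeight b (c R) (c (R + 1)) (S j (c (R + 1))) := sum_range_succ _ _
  have h2 : (hits (S j) c m (R + 1) : ℝ) = hits (S j) c m R +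
      if S j (c (R + 1)) (m R) then 1 else 0 := by
    unfold hits
    rw [range_add_one, filter_insert]
    split_ifs
    · rw [card_insert_of_notMem (by simp)]
      push_cast
      rfl
    · simp
  rw [← Real.exp_add, ← Real.exp_add, ← Real.exp_add, h1, h2]
  congr 1
  ring

/-- The position `x` ends a run in which the potential never exceeded `1`, and at most `n` edges
have been coloured since Maker's last decision, his own edge included. Thus `n = 1` is for Breaker
to move, and `n = b + 1` for Maker to move. -/
def Tracked (b : ℕ) (S : ι → PartialColouring G k → G.edgeSet × Fin k → Prop) (ℓ : ι → ℝ)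
    (n : ℕ) (x : PartialColouring G k) : Prop :=
  ∃ R c m, Run b R c m ∧ c (R + 1) = x ∧ #(newEdges (c R) x) ≤ n ∧
    ∀ r ≤ R, potential b S ℓ c m r ≤ 1

theorem tracked_empty (hℓ : ∑ j, Real.exp (-ℓ j) ≤ 1) (m₀ : G.edgeSet × Fin k) (n : ℕ) :
    Tracked b S ℓ n fun _ => none := by
  refine ⟨0, fun _ _ => none, fun _ => m₀, ⟨rfl, fun _ _ => .refl _, fun _ _ => ?_, ?_, ?_, ?_⟩,
    rfl, ?_, ?_⟩
  · simp [newEdges_self]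
  · simp
  · simp
  · intro e f i _ he
    cases he
  · simp [newEdges_self]
  · intro r hr
    obtain rfl : r = 0 := by omega
    simpa [potential, drift, hits] using hℓ

theorem Tracked.breakerTurn {x y : PartialColouring G k} {mayPass : Bool}
    (h : Tracked b S ℓ 1 x) (hxy : BreakerTurn b mayPass x y) : Tracked b S ℓ (b + 1) y := by
  obtain ⟨R, c, m, hrun, rfl, hnew, hpot⟩ := h
  obtain ⟨n, hn, -, hturn⟩ := hxy
  obtain ⟨hext, hcard, hproper⟩ := hturn.extends_and hrun.proper
  have hc : ∀ r ≤ R, Function.update c (R + 1) y r = c r := fun r hr =>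
    Function.update_of_ne (by omega) _ _
  have hy : Function.update c (R + 1) y (R + 1) = y := Function.update_self _ _ _
  have hcard' : #(newEdges (c R) y) ≤ b + 1 := by
    have := card_newEdges_le_add (c R) (c (R + 1)) y
    omega
  refine ⟨R, Function.update c (R + 1) y, m, ⟨?_, fun r hr => ?_, fun r hr => ?_,
    fun r hr => ?_, fun r hr => ?_, ?_⟩, hy, ?_, fun r hr => ?_⟩
  · rw [hc 0 (by omega), hrun.start]
  · rcases hr.lt_or_eq with h | rfl
    · rw [hc r hr, hc (r + 1) h]
      exact hrun.ext_succ r hr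
    · rw [hc r le_rfl, hy]
      exact (hrun.ext_succ r le_rfl).trans hext
  · rcases hr.lt_or_eq with h | rfl
    · rw [hc r hr, hc (r + 1) h]
      exact hrun.few r hr
    · rwa [hc r le_rfl, hy]
  · rw [hc (r + 1) hr]
    exact hrun.legal r hr
  · rcases (show r + 2 ≤ R + 1 by omega).lt_or_eq with h | h
    · rw [hc (r + 2) (by omega)]
      exact hrun.played r hr
    · rw [h, hy]
      refine hext.eq_some ?_
      rw [← h]
      exact hrun.played r hr
  · rwa [hy]
  · rwa [hc R le_rfl]
  · rw [potential_congr (c' := c) (m' := m) (fun s hs => hc s (hs.trans hr)) fun _ _ => rfl]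
    exact hpot r hr

theorem Tracked.exists_move {x : PartialColouring G k} (h : Tracked b S ℓ (b + 1) x)
    {m₀ : G.edgeSet × Fin k} (hm₀ : Legal x m₀) :
    ∃ y, ColoursEdge x y ∧ Tracked b S ℓ 1 y := by
  obtain ⟨R, c, m, hrun, rfl, hnew, hpot⟩ := h
  have hext := hrun.ext_succ R le_rfl
  obtain ⟨μ, hμ, hle⟩ := exists_legal_sum_exp_le (Legal (c (R + 1))) m₀ hm₀
    (moveWeight b (c R) (c (R + 1))) (moveWeight_nonneg hext)
    (fun μ hμ => by
      by_contra hcon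
      exact hμ (if_neg hcon))
    (sum_moveWeight_le_one hext hnew) (fun j => S j (c (R + 1)))
    (fun j => Real.exp (-ℓ j) * Real.exp (drift b (S j) c R / 2 - hits (S j) c m R))
    (fun j => by positivity)
  set y : PartialColouring G k := Function.update (c (R + 1)) μ.1 (some μ.2) with hydef
  have hxy : ColoursEdge (c (R + 1)) y := ⟨μ.1, μ.2, hμ.1, hμ.2, rfl⟩
  refine ⟨y, hxy, ?_⟩
  have hc : ∀ r ≤ R + 1, Function.update c (R + 2) y r = c r := fun r hr =>
    Function.update_of_ne (by omega) _ _
  have hm : ∀ r < R, Function.update m R μ r = m r := fun r hr =>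
    Function.update_of_ne (by omega) _ _
  have hy : Function.update c (R + 2) y (R + 2) = y := Function.update_self _ _ _
  have hmR : Function.update m R μ R = μ := Function.update_self _ _ _
  refine ⟨R + 1, Function.update c (R + 2) y, Function.update m R μ,
    ⟨?_, fun r hr => ?_, fun r hr => ?_, fun r hr => ?_, fun r hr => ?_, ?_⟩, hy, ?_,
    fun r hr => ?_⟩
  · rw [hc 0 (by omega), hrun.start]
  · rcases hr.lt_or_eq with h | rfl
    · rw [hc r hr, hc (r + 1) h]
      exact hrun.ext_succ r (by omega)
    · rw [hc (R + 1) le_rfl, hy]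
      exact hxy.extends
  · rcases hr.lt_or_eq with h | rfl
    · rw [hc r hr, hc (r + 1) h]
      exact hrun.few r (by omega)
    · rw [hc (R + 1) le_rfl, hy]
      exact hxy.card_newEdges_le.trans (by omega)
  · rw [hc (r + 1) hr]
    rcases (Nat.lt_succ_iff.1 hr).lt_or_eq with h | rfl
    · rw [hm r h]
      exact hrun.legal r h
    · rwa [hmR]
  · rcases (Nat.lt_succ_iff.1 hr).lt_or_eq with h | rfl
    · rw [hc (r + 2) (by omega), hm r h]
      exact hrun.played r h
    · rw [hmR, hy, hydef, Function.update_self]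
  · rw [hy]
    exact hxy.proper hrun.proper
  · rw [hc (R + 1) le_rfl]
    exact hxy.card_newEdges_le
  · rcases hr.lt_or_eq with h | rfl
    · rw [potential_congr (c' := c) (m' := m) (fun s hs => hc s (by omega))
        fun s hs => hm s (by omega)]
      exact hpot r (by omega)
    · rw [potential_congr (c' := c) (m' := Function.update m R μ) (fun s hs => hc s hs)
        fun _ _ => rfl, potential_succ, hmR]
      have h1 : ∀ j, hits (S j) c (Function.update m R μ) R = hits (S j) c m R := by
        intro j
        unfold hits
        congr 1
        refine filter_congr fun r hr => ?_
        rw [hm r (mem_range.1 hr)]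
      simp only [h1]
      exact hle.trans (hpot R le_rfl)

/-- Maker wins if control of the hits of the events `S j` rules out blocked edges. -/
theorem makerWins_of_tracked (hb : 1 ≤ b) (mayPass : Bool) (first : Player)
    (hℓ : ∑ j, Real.exp (-ℓ j) ≤ 1) (m₀ : G.edgeSet × Fin k)
    (hav : ∀ (R : ℕ) (c : ℕ → PartialColouring G k) (m : ℕ → G.edgeSet × Fin k), Run b R c m →
      (∀ r ≤ R, ∀ j, drift b (S j) c r / 2 - ℓ j ≤ hits (S j) c m r) →
      ∀ e, c (R + 1) e = none → ∃ i, Available (c (R + 1)) e i) :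
    MakerWins G b mayPass first k := by
  have hlegal : ∀ n x, Tracked b S ℓ n x → ∀ e, x e = none → ∃ i, Legal x (e, i) := by
    rintro n x ⟨R, c, m, hrun, rfl, -, hpot⟩ e he
    obtain ⟨i, hi⟩ := hav R c m hrun (fun r hr => drift_div_two_sub_le_hits (hpot r hr)) e he
    exact ⟨i, he, hi⟩
  refine makerWins_of_invariant hb mayPass first (Tracked b S ℓ (b + 1)) (Tracked b S ℓ 1)
    (tracked_empty hℓ m₀ _) (tracked_empty hℓ m₀ _) ?_ (fun x y hx hxy => hx.breakerTurn hxy) ?_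
  · rintro x hx ⟨e, he⟩
    obtain ⟨i, hi⟩ := hlegal _ x hx e he
    exact hx.exists_move hi
  · rintro x hx ⟨e, he⟩
    obtain ⟨i, hi⟩ := hlegal _ x hx e he
    exact ⟨_, e, i, hi.1, hi.2, rfl⟩

/-- The events that Maker keeps track of, for all sets of `ω` vertices with all sets of colours, and
for all pairs of vertices. -/
def trackedEvent (D ω : ℕ) : ({W : Finset V // #W = ω} × Finset (Fin k)) ⊕ (V × V) →
    PartialColouring G k → G.edgeSet × Fin k → Prop :=
  Sum.elim (fun j => YoungAvoiding D j.1.1 j.2) fun j => Gain j.1 j.2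

/-- The existence of an edge serves to exclude graphs with fewer than two vertices, for which
`log v(G)` is `0`. The hypothesis `hDk` says that `k + 1` exceeds `(2 - 1 / K) * D`. -/
theorem makerWins_of_large {D ω K : ℕ} (hb : 1 ≤ b) (mayPass : Bool) (first : Player)
    (e₀ : G.edgeSet) (hD : ∀ v, #(edgesAt G v) ≤ D)
    (hω : ω = 2 ^ 14 * b) (hK : K = 2 ^ 7 * ω ^ 2 * b) (hkD : k ≤ 2 * D)
    (hDk : K * (2 * D) < K * (k + 1) + D) (hKD : 8 * K * Real.log (Fintype.card V) ≤ D) :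
    MakerWins G b mayPass first k := by
  have hcard : 2 ≤ Fintype.card V := by
    rw [← card_endpoints e₀]
    exact card_le_univ _
  set N := Fintype.card V with hN
  have hNr : (2 : ℝ) ≤ N := by exact_mod_cast hcard
  have hω1 : 2 ^ 14 ≤ ω := by omega
  have hω2 : ω ≤ ω ^ 2 := Nat.le_self_pow (by norm_num) _
  have hKω : 2 ^ 7 * ω ^ 2 ≤ K := by rw [hK]; exact Nat.le_mul_of_pos_right _ hb
  have hKr : (1 : ℝ) ≤ K := by exact_mod_cast (show 1 ≤ K by omega)
  have hωK : (ω : ℝ) ≤ K := by exact_mod_cast (show ω ≤ K by omega)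
  have hlog2 := Real.log_two_gt_d9
  have hlog2' := Real.log_two_lt_d9
  have hlog : Real.log 2 ≤ Real.log N := Real.log_le_log (by norm_num) hNr
  have hKD2 : 2 * K ≤ D := by
    have : (2 * K : ℝ) ≤ D := by nlinarith
    exact_mod_cast this
  have hk : 0 < k := by
    by_contra h0
    obtain rfl : k = 0 := by omega
    have : 1 * D ≤ K * D := Nat.mul_le_mul_right _ (by omega)
    nlinarith
  obtain ⟨L₁, hL₁⟩ : ∃ L₁, L₁ = Real.log (2 * ((N : ℝ) ^ ω * 2 ^ k)) := ⟨_, rfl⟩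
  obtain ⟨L₂, hL₂⟩ : ∃ L₂, L₂ = Real.log (2 * (N : ℝ) ^ 2) := ⟨_, rfl⟩
  have hL₁' : L₁ ≤ 3 * D := by
    rw [hL₁, Real.log_mul (by norm_num) (by positivity), Real.log_mul (by positivity)
      (by positivity), Real.log_pow, Real.log_pow]
    have h1 : (k : ℝ) ≤ 2 * D := by exact_mod_cast hkD
    have h2 : ω * Real.log N ≤ K * Real.log N := by gcongr
    have h3 : (k : ℝ) * Real.log 2 ≤ 2 * D * 1 := by gcongr; linarith
    have h4 : (2 * K : ℝ) ≤ D := by exact_mod_cast hKD2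
    linarith
  have hL₂' : L₂ ≤ D / K := by
    rw [hL₂, Real.log_mul (by norm_num) (by positivity), Real.log_pow, le_div_iff₀ (by linarith)]
    push_cast
    nlinarith
  refine makerWins_of_tracked (S := trackedEvent D ω)
    (ℓ := Sum.elim (fun _ => L₁) fun _ => L₂) hb mayPass first ?_ (e₀, ⟨0, hk⟩) ?_
  · -- each of the two kinds of events has initial weight at most `1 / 2`
    rw [Fintype.sum_sum_type]
    simp only [Sum.elim_inl, Sum.elim_inr, sum_const, card_univ, nsmul_eq_mul,
      Fintype.card_prod, Fintype.card_finset_len, Fintype.card_finset, Fintype.card_fin]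
    rw [hL₁, hL₂, Real.exp_neg, Real.exp_neg, Real.exp_log (by positivity),
      Real.exp_log (by positivity), ← hN]
    have h1 : ((N.choose ω * 2 ^ k : ℕ) : ℝ) ≤ (N : ℝ) ^ ω * 2 ^ k := by
      have := Nat.choose_le_pow N ω
      push_cast
      gcongr
      exact_mod_cast this
    have h2 : ((N.choose ω * 2 ^ k : ℕ) : ℝ) * (2 * ((N : ℝ) ^ ω * 2 ^ k))⁻¹ ≤ 1 / 2 := by
      rw [← div_eq_mul_inv, div_le_iff₀ (by positivity)]
      linarith
    have h3 : ((N * N : ℕ) : ℝ) * (2 * (N : ℝ) ^ 2)⁻¹ = 1 / 2 := by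
      push_cast
      field_simp
    linarith
  · intro R c m hrun hbal e he
    exact hrun.exists_available hb hD hω hK hKD2 hkD hDk hL₁' hL₂'
      (fun r hr W A hW => hbal r hr (Sum.inl (⟨W, hW⟩, A)))
      (fun u v => hbal R le_rfl (Sum.inr (u, v))) he

theorem card_edgesAt_le_maxDegree [DecidableRel G.Adj] (v : V) :
    #(edgesAt G v) ≤ G.maxDegree := by
  refine le_trans ?_ (G.degree_le_maxDegree v)
  rw [← G.card_incidenceFinset_eq_degree, ← card_map (Function.Embedding.subtype _)]
  refine card_le_card fun e he => ?_
  simp only [mem_map, mem_edgesAt, Function.Embedding.subtype_apply] at he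
  obtain ⟨e, hv, rfl⟩ := he
  rw [SimpleGraph.mem_incidenceFinset]
  exact ⟨e.2, hv⟩

end Strategy

theorem makerWins_of_isEmpty {V : Type*} {G : SimpleGraph V} {b k : ℕ}
    (mayPass : Bool) (first : Player) (h : IsEmpty G.edgeSet) :
    MakerWins G b mayPass first k :=
  ⟨fun _ _ => none, fun _ _ _ _ _ e => h.elim e⟩

end EdgeColouringGame

theorem theorem2 :
    ∃ c : ℝ, 0 < c ∧ ∀ b : ℕ, 1 ≤ b → ∃ C : ℝ, 0 < C ∧
      ∀ (V : Type*) [Fintype V] (G : SimpleGraph V) [DecidableRel G.Adj],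
        C * Real.log (Fintype.card V) ≤ (G.maxDegree : ℝ) →
        ∀ (mayPass : Bool) (first : EdgeColouringGame.Player),
          (EdgeColouringGame.gameChromaticIndex G b mayPass first : ℝ) ≤
            (2 - c * ((b : ℝ) ^ 4)⁻¹) * (G.maxDegree : ℝ) := by
  refine ⟨1 / 2 ^ 35, by positivity, fun b hb => ⟨2 ^ 38 * b ^ 3, ?_, ?_⟩⟩
  · have : (0 : ℝ) < b := by exact_mod_cast hb
    positivity
  intro V _ G _ hlog mayPass first
  set D := G.maxDegree with hD
  have hb' : (1 : ℝ) ≤ b := by exact_mod_cast hb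
  have hε0 : 0 < (1 / 2 ^ 35 : ℝ) * ((b : ℝ) ^ 4)⁻¹ := by positivity
  have hε : (1 / 2 ^ 35 : ℝ) * ((b : ℝ) ^ 4)⁻¹ ≤ 1 := by
    have : ((b : ℝ) ^ 4)⁻¹ ≤ 1 := inv_le_one_of_one_le₀ (one_le_pow₀ hb')
    linarith
  have hKε : 2 ^ 35 * (b : ℝ) ^ 3 * ((1 / 2 ^ 35 : ℝ) * ((b : ℝ) ^ 4)⁻¹) ≤ 1 := by
    have h1 : 2 ^ 35 * (b : ℝ) ^ 3 * ((1 / 2 ^ 35 : ℝ) * ((b : ℝ) ^ 4)⁻¹) = (b : ℝ)⁻¹ := by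
      field_simp
    rw [h1]
    exact inv_le_one_of_one_le₀ hb'
  set ε := (1 / 2 ^ 35 : ℝ) * ((b : ℝ) ^ 4)⁻¹ with hεdef
  have hnn : 0 ≤ (2 - ε) * (D : ℝ) := mul_nonneg (by linarith) (by positivity)
  suffices h : EdgeColouringGame.MakerWins G b mayPass first ⌊(2 - ε) * (D : ℝ)⌋₊ by
    refine le_trans ?_ (Nat.floor_le hnn)
    exact_mod_cast Nat.sInf_le h
  rcases isEmpty_or_nonempty G.edgeSet with hE | ⟨⟨e₀⟩⟩
  · exact EdgeColouringGame.makerWins_of_isEmpty mayPass first hE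
  have hlt := Nat.lt_floor_add_one ((2 - ε) * (D : ℝ))
  have hle := Nat.floor_le hnn
  set k := ⌊(2 - ε) * (D : ℝ)⌋₊
  have hDnn : (0 : ℝ) ≤ D := by positivity
  refine EdgeColouringGame.makerWins_of_large (D := D) (K := 2 ^ 35 * b ^ 3) hb mayPass first e₀
    EdgeColouringGame.card_edgesAt_le_maxDegree rfl (by ring) ?_ ?_ ?_
  · have : (k : ℝ) ≤ 2 * D := by nlinarith
    exact_mod_cast this
  · have : (2 ^ 35 * b ^ 3 : ℝ) * (2 * D) < 2 ^ 35 * b ^ 3 * (k + 1) + D := by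
      have h1 : (2 ^ 35 * b ^ 3 : ℝ) * ((2 - ε) * D) < 2 ^ 35 * b ^ 3 * (k + 1) :=
        mul_lt_mul_of_pos_left hlt (by positivity)
      have h2 := mul_le_mul_of_nonneg_right hKε hDnn
      nlinarith
    exact_mod_cast this
  · push_cast
    linarith
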